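/- Let $n$ and $m$ be coprime integers with $m>0$, let $\theta=n/m$, and let $\mathbb{T}^2_\theta$ be the noncommutative torus, i.e. the universal unital $C^*$-algebra generated by unitaries $U,V$ with $UV=e^{2\pi i\theta}VU$. Let $A=Z(\mathbb{T}^2_\theta)$ be its centre. Then $A\cong C(\mathbb{T}^2)$ as $C^*$-algebras, with $U^m$ and $V^m$ corresponding to the two coordinate functions, and there is a commutative Hopf algebroid $\mathcal{H}$ such that $(\mathbb{T}^2_\theta,\mathcal{H})$ is a local covering of $A$; one can take $\mathcal{H}=C(G,A)$, the functions on $G=\mathbb{Z}/m\times\mathbb{Z}/m$ with values in $A$, with pointwise product, sources and targets the inclusion of the constant functions, counits $\epsilon f=f(1)$, antipode $(Sf)(g)=f(g^{-1})$ and coproducts $(\Delta f)(g,h)=f(gh)$ in $\mathcal{H}\otimes_A\mathcal{H}\cong C(G\times G,A)$. Here a Hopf algebroid $\mathcal{H}=(\mathcal{H}_L,\mathcal{H}_R,S)$ consists of a left bialgebroid over $L$ and a right bialgebroid over $R$ with the same underlying $\mathbb{C}$-algebra $H$, and a bijective antipode $S$; it is commutative if $H$, $L$ and $R$ are commutative.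 A (finite, Galois) covering of an algebra $A$ is a pair $(B,\mathcal{H})$ such that $\mathcal{H}$ is a finitely generated projective Hopf algebroid over a subalgebra $R=A'\subseteq A$; $A\subseteq B$ is a right $\mathcal{H}$-Galois extension, that is, $B$ is a right $\mathcal{H}$-comodule algebra with coinvariants $A$ for both coactions, and the Galois maps $B\otimes_A B\to B\otimes_R H$, $a\otimes b\mapsto ab^{[0]}\otimes b^{[1]}$, and $B\otimes_A B\to B\otimes_L H$, $a\otimes b\mapsto a_{[0]}b\otimes a_{[1]}$, are bijective; and $B$ is a finitely generated projective $A$-module. The covering is local if $A'=A$. -/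

import Mathlib

open scoped TensorProduct ENNReal
open MulOpposite

universe u v w x

/-! ### Actions and balanced tensor products over noncommutative rings -/

section Actions

variable {k : Type u} [CommRing k] {R : Type v} [Ring R] [Algebra k R]
variable {H : Type w} [Ring H] [Algebra k H]

/-- The action of `R` on `H` through left multiplication by `f r`:  `r ↦ (h ↦ f r * h)`. -/
noncomputable def lmulAct (f : R →ₐ[k] H) : R →ₐ[k] Module.End k H :=
  (Algebra.lmul k H).comp f

/-- The right regular action of `H`:  `op a ↦ (h ↦ h * a)`. -/
noncomputable def rmulEnd : Hᵐᵒᵖ →ₐ[k] Module.End k H :=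
  Algebra.lsmul k k H

/-- The right action of `R` on `H` through right multiplication by `f r`:
`op r ↦ (h ↦ h * f r)`. -/
noncomputable def rmulAct (f : R →ₐ[k] H) : Rᵐᵒᵖ →ₐ[k] Module.End k H :=
  rmulEnd.comp (AlgHom.op f)

/-- The left action of `R` on `H` through right multiplication by the values of a map
`t : Rᵐᵒᵖ →ₐ H`:  `r ↦ (h ↦ h * t (op r))`. -/
noncomputable def rmulActOp (t : Rᵐᵒᵖ →ₐ[k] H) : R →ₐ[k] Module.End k H :=
  rmulEnd.comp (AlgHom.opComm.symm t)

@[simp] theorem lmulAct_apply (f : R →ₐ[k] H) (r : R) (h : H) : lmulAct f r h = f r * h := rfl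

@[simp] theorem rmulAct_apply (f : R →ₐ[k] H) (r : R) (h : H) :
    rmulAct f (op r) h = h * f r := rfl

@[simp] theorem rmulActOp_apply (t : Rᵐᵒᵖ →ₐ[k] H) (r : R) (h : H) :
    rmulActOp t r h = h * t (op r) := rfl

/-- The module over the `k`-algebra `R` given by an action `φ` on the `k`-module `M` is finitely
generated and projective. (A right module is an action of `Rᵐᵒᵖ`.) -/
def IsFGProjective {M : Type w} [AddCommGroup M] [Module k M] (φ : R →ₐ[k] Module.End k M) :
    Prop :=
  letI : Module R M := Module.compHom M φ.toRingHom
  Module.Finite R M ∧ Module.Projective R M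

end Actions

section Balanced

variable {k : Type*} [CommRing k] {R S : Type*} [Ring R] [Algebra k R] [Ring S] [Algebra k S]
variable {M N P : Type*} [AddCommGroup M] [Module k M] [AddCommGroup N] [Module k N]
  [AddCommGroup P] [Module k P]

/-- The relations `m · r ⊗ n - m ⊗ r · n`, for a right `R`-module `M` (action `a`) and a left
`R`-module `N` (action `b`). -/
def balRel (a : Rᵐᵒᵖ →ₐ[k] Module.End k M) (b : R →ₐ[k] Module.End k N) :
    Submodule k (M ⊗[k] N) :=
  Submodule.span k
    {z | ∃ (r : R) (m : M) (n : N), z = a (op r) m ⊗ₜ[k] n - m ⊗ₜ[k] b r n}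

/-- The balanced tensor product `M ⊗_R N` of a right and a left module over the possibly
noncommutative `k`-algebra `R`. -/
abbrev BalTensor (a : Rᵐᵒᵖ →ₐ[k] Module.End k M) (b : R →ₐ[k] Module.End k N) : Type _ :=
  (M ⊗[k] N) ⧸ balRel a b

/-- The canonical projection `M ⊗_k N → M ⊗_R N`. We call `x` a representative of `bmk a b x`. -/
abbrev bmk (a : Rᵐᵒᵖ →ₐ[k] Module.End k M) (b : R →ₐ[k] Module.End k N) :
    M ⊗[k] N →ₗ[k] BalTensor a b :=
  (balRel a b).mkQ

/-- The relations defining `M ⊗_R N ⊗_S P`. -/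
def balRel₃ (a : Rᵐᵒᵖ →ₐ[k] Module.End k M) (b : R →ₐ[k] Module.End k N)
    (c : Sᵐᵒᵖ →ₐ[k] Module.End k N) (d : S →ₐ[k] Module.End k P) :
    Submodule k ((M ⊗[k] N) ⊗[k] P) :=
  Submodule.span k
    ({z | ∃ (r : R) (m : M) (n : N) (p : P),
        z = (a (op r) m ⊗ₜ[k] n) ⊗ₜ[k] p - (m ⊗ₜ[k] b r n) ⊗ₜ[k] p} ∪
      {z | ∃ (s : S) (m : M) (n : N) (p : P),
        z = (m ⊗ₜ[k] c (op s) n) ⊗ₜ[k] p - (m ⊗ₜ[k] n) ⊗ₜ[k] d s p})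

/-- The triple tensor product `M ⊗_R N ⊗_S P`. -/
abbrev BalTensor₃ (a : Rᵐᵒᵖ →ₐ[k] Module.End k M) (b : R →ₐ[k] Module.End k N)
    (c : Sᵐᵒᵖ →ₐ[k] Module.End k N) (d : S →ₐ[k] Module.End k P) : Type _ :=
  ((M ⊗[k] N) ⊗[k] P) ⧸ balRel₃ a b c d

variable (a : Rᵐᵒᵖ →ₐ[k] Module.End k M) (b : R →ₐ[k] Module.End k N)
  (c : Sᵐᵒᵖ →ₐ[k] Module.End k N) (d : S →ₐ[k] Module.End k P)

/-- The canonical map `(M ⊗_R N) ⊗_k P → M ⊗_R N ⊗_S P`. -/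
noncomputable def joinLeft : BalTensor a b ⊗[k] P →ₗ[k] BalTensor₃ a b c d :=
  TensorProduct.lift
    ((balRel a b).liftQ (TensorProduct.curry (balRel₃ a b c d).mkQ) (by
      refine Submodule.span_le.2 ?_
      rintro _ ⟨r, m, n, rfl⟩
      refine LinearMap.ext fun p => ?_
      have h : (a (op r) m ⊗ₜ[k] n) ⊗ₜ[k] p - (m ⊗ₜ[k] b r n) ⊗ₜ[k] p ∈ balRel₃ a b c d :=
        Submodule.subset_span (Or.inl ⟨r, m, n, p, rfl⟩)
      simpa [TensorProduct.sub_tmul, ← Submodule.mkQ_apply, sub_eq_zero] using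
        (Submodule.Quotient.mk_eq_zero _).2 h))

/-- The canonical map `M ⊗_k (N ⊗_S P) → M ⊗_R N ⊗_S P`. -/
noncomputable def joinRight : M ⊗[k] BalTensor c d →ₗ[k] BalTensor₃ a b c d :=
  TensorProduct.lift
    ((balRel c d).liftQ
      (TensorProduct.curry ((balRel₃ a b c d).mkQ ∘ₗ
        (TensorProduct.assoc k M N P).symm.toLinearMap)).flip (by
      refine Submodule.span_le.2 ?_
      rintro _ ⟨s, n, p, rfl⟩
      refine LinearMap.ext fun m => ?_
      have h : (m ⊗ₜ[k] c (op s) n) ⊗ₜ[k] p - (m ⊗ₜ[k] n) ⊗ₜ[k] d s p ∈ balRel₃ a b c d :=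
        Submodule.subset_span (Or.inr ⟨s, m, n, p, rfl⟩)
      simpa [TensorProduct.tmul_sub, ← Submodule.mkQ_apply, sub_eq_zero] using
        (Submodule.Quotient.mk_eq_zero _).2 h)).flip

variable {a b c d}

/-- `f ⊗ id`, evaluated on representatives, for `f` with values in `M ⊗_R N`. -/
noncomputable def extLeft {Q : Type*} [AddCommGroup Q] [Module k Q] (f : Q →ₗ[k] BalTensor a b) :
    Q ⊗[k] P →ₗ[k] BalTensor₃ a b c d :=
  joinLeft a b c d ∘ₗ f.rTensor P

/-- `id ⊗ g`, evaluated on representatives, for `g` with values in `N ⊗_S P`. -/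
noncomputable def extRight {Q : Type*} [AddCommGroup Q] [Module k Q] (g : Q →ₗ[k] BalTensor c d) :
    M ⊗[k] Q →ₗ[k] BalTensor₃ a b c d :=
  joinRight a b c d ∘ₗ g.lTensor M

end Balanced

/-! ### Bialgebroids and Hopf algebroids

An identity between Sweedler expressions, that is, between maps applied to an element `z` of a
balanced tensor product, is required for all representatives `x` of `z` in the tensor product over
`k`; so it includes that the expression does not depend on the representative. -/

section Bialgebroids

variable (k : Type u) [CommRing k]

/-- Left `L`-bialgebroids, with `L`-bimodule structure `l · h · l' = s(l) t(l') h`. -/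
structure LeftBialgebroid (L : Type v) [Ring L] [Algebra k L] (H : Type w) [Ring H]
    [Algebra k H] where
  /-- source -/
  s : L →ₐ[k] H
  /-- target -/
  t : Lᵐᵒᵖ →ₐ[k] H
  /-- coproduct `H → H ⊗_L H` -/
  Δ : H →ₗ[k] BalTensor (lmulAct t) (lmulAct s)
  /-- counit -/
  ε : H →ₗ[k] L
  source_target_comm : ∀ (l : L) (l' : Lᵐᵒᵖ), s l * t l' = t l' * s l
  /-- `Δ` is a bimodule map. -/
  Δ_bimodule : ∀ (l l' : L) (h : H) (x : H ⊗[k] H), bmk _ _ x = Δ h →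
    Δ (s l * t (op l') * h) = bmk _ _ ((s l ⊗ₜ[k] t (op l')) * x)
  /-- `ε` is a bimodule map. -/
  ε_bimodule : ∀ (l l' : L) (h : H), ε (s l * t (op l') * h) = l * ε h * l'
  /-- coassociativity, in `H ⊗_L H ⊗_L H` -/
  coassoc : ∀ (h : H) (x : H ⊗[k] H), bmk _ _ x = Δ h →
    (extLeft Δ x : BalTensor₃ (lmulAct t) (lmulAct s) (lmulAct t) (lmulAct s)) = extRight Δ x
  /-- `ε(h₁) · h₂ = h` -/
  counit_left : ∀ (h : H) (x : H ⊗[k] H), bmk _ _ x = Δ h →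
    LinearMap.mul' k H (TensorProduct.map (s.toLinearMap ∘ₗ ε) LinearMap.id x) = h
  /-- `h₁ · ε(h₂) = h` -/
  counit_right : ∀ (h : H) (x : H ⊗[k] H), bmk _ _ x = Δ h →
    LinearMap.mul' k H (TensorProduct.comm k H H
      (TensorProduct.map LinearMap.id
        (t.toLinearMap ∘ₗ (opLinearEquiv k).toLinearMap ∘ₗ ε) x)) = h
  /-- `Δ` takes values in the Takeuchi product. -/
  takeuchi : ∀ (l : L) (h : H) (x : H ⊗[k] H), bmk _ _ x = Δ h →
    bmk (lmulAct t) (lmulAct s) (x * (t (op l) ⊗ₜ[k] 1)) =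
      bmk (lmulAct t) (lmulAct s) (x * (1 ⊗ₜ[k] s l))
  /-- `Δ` is unital and multiplicative. -/
  Δ_one : Δ 1 = bmk _ _ (1 ⊗ₜ[k] 1)
  Δ_mul : ∀ (h h' : H) (x x' : H ⊗[k] H), bmk _ _ x = Δ h → bmk _ _ x' = Δ h' →
    Δ (h * h') = bmk _ _ (x * x')
  /-- `h · l := ε(h s(l))` is a left action of `H` on `L` which extends the regular one. -/
  ε_extends : ∀ l l' : L, ε (s l * s l') = l * l'
  ε_one_action : ∀ l : L, ε (1 * s l) = l
  ε_mul_action : ∀ (h h' : H) (l : L), ε (h * h' * s l) = ε (h * s (ε (h' * s l)))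

/-- Right `R`-bialgebroids, with `R`-bimodule structure `r · h · r' = h s(r') t(r)`. -/
structure RightBialgebroid (R : Type v) [Ring R] [Algebra k R] (H : Type w) [Ring H]
    [Algebra k H] where
  /-- source -/
  s : R →ₐ[k] H
  /-- target -/
  t : Rᵐᵒᵖ →ₐ[k] H
  /-- coproduct `H → H ⊗_R H` -/
  Δ : H →ₗ[k] BalTensor (rmulAct s) (rmulActOp t)
  /-- counit -/
  ε : H →ₗ[k] R
  source_target_comm : ∀ (r : R) (r' : Rᵐᵒᵖ), s r * t r' = t r' * s r
  /-- `Δ` is a bimodule map. -/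
  Δ_bimodule : ∀ (r r' : R) (h : H) (x : H ⊗[k] H), bmk _ _ x = Δ h →
    Δ (h * s r' * t (op r)) = bmk _ _ (x * (t (op r) ⊗ₜ[k] s r'))
  /-- `ε` is a bimodule map. -/
  ε_bimodule : ∀ (r r' : R) (h : H), ε (h * s r' * t (op r)) = r * ε h * r'
  /-- coassociativity, in `H ⊗_R H ⊗_R H` -/
  coassoc : ∀ (h : H) (x : H ⊗[k] H), bmk _ _ x = Δ h →
    (extLeft Δ x : BalTensor₃ (rmulAct s) (rmulActOp t) (rmulAct s) (rmulActOp t)) = extRight Δ x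
  /-- `ε(h₁) · h₂ = h` -/
  counit_left : ∀ (h : H) (x : H ⊗[k] H), bmk _ _ x = Δ h →
    LinearMap.mul' k H (TensorProduct.comm k H H
      (TensorProduct.map (t.toLinearMap ∘ₗ (opLinearEquiv k).toLinearMap ∘ₗ ε)
        LinearMap.id x)) = h
  /-- `h₁ · ε(h₂) = h` -/
  counit_right : ∀ (h : H) (x : H ⊗[k] H), bmk _ _ x = Δ h →
    LinearMap.mul' k H (TensorProduct.map LinearMap.id (s.toLinearMap ∘ₗ ε) x) = h
  /-- `Δ` takes values in the Takeuchi product. -/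
  takeuchi : ∀ (r : R) (h : H) (x : H ⊗[k] H), bmk _ _ x = Δ h →
    bmk (rmulAct s) (rmulActOp t) ((s r ⊗ₜ[k] 1) * x) =
      bmk (rmulAct s) (rmulActOp t) ((1 ⊗ₜ[k] t (op r)) * x)
  /-- `Δ` is unital and multiplicative. -/
  Δ_one : Δ 1 = bmk _ _ (1 ⊗ₜ[k] 1)
  Δ_mul : ∀ (h h' : H) (x x' : H ⊗[k] H), bmk _ _ x = Δ h → bmk _ _ x' = Δ h' →
    Δ (h * h') = bmk _ _ (x * x')
  /-- `r · h := ε(s(r) h)` is a right action of `H` on `R` which extends the regular one. -/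
  ε_extends : ∀ r r' : R, ε (s r * s r') = r * r'
  ε_one_action : ∀ r : R, ε (s r * 1) = r
  ε_mul_action : ∀ (h h' : H) (r : R), ε (s r * (h * h')) = ε (s (ε (s r * h)) * h')

/-- Hopf algebroids (with bijective antipode) with underlying `k`-algebra `H`, over the
`k`-algebras `L` and `R`. -/
structure HopfAlgebroid (L R : Type v) [Ring L] [Algebra k L] [Ring R] [Algebra k R]
    (H : Type w) [Ring H] [Algebra k H] where
  /-- the constituent left bialgebroid -/
  left : LeftBialgebroid k L H
  /-- the constituent right bialgebroid -/
  right : RightBialgebroid k R H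
  /-- the antipode -/
  S : H ≃ₗ[k] H
  sL_εL_tR : ∀ r : R, left.s (left.ε (right.t (op r))) = right.t (op r)
  tR_εR_sL : ∀ l : L, right.t (op (right.ε (left.s l))) = left.s l
  tL_εL_sR : ∀ r : R, left.t (op (left.ε (right.s r))) = right.s r
  sR_εR_tL : ∀ l : L, right.s (right.ε (left.t (op l))) = left.t (op l)
  /-- `(Δ_L ⊗_R id) Δ_R = (id ⊗_L Δ_R) Δ_L`, in `H ⊗_L H ⊗_R H` -/
  Δ_comm_LR : ∀ (h : H) (x y : H ⊗[k] H), bmk _ _ x = right.Δ h → bmk _ _ y = left.Δ h →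
    (extLeft left.Δ x : BalTensor₃ (lmulAct left.t) (lmulAct left.s)
      (rmulAct right.s) (rmulActOp right.t)) = extRight right.Δ y
  /-- `(Δ_R ⊗_L id) Δ_L = (id ⊗_R Δ_L) Δ_R`, in `H ⊗_R H ⊗_L H` -/
  Δ_comm_RL : ∀ (h : H) (x y : H ⊗[k] H), bmk _ _ x = right.Δ h → bmk _ _ y = left.Δ h →
    (extLeft right.Δ y : BalTensor₃ (rmulAct right.s) (rmulActOp right.t)
      (lmulAct left.t) (lmulAct left.s)) = extRight left.Δ x
  S_bimodule : ∀ (l : L) (r : R) (h : H),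
    S (left.t (op l) * h * right.t (op r)) = right.s r * S h * left.s l
  /-- `S(h₁) h₂ = s_R (ε_R h)` for the coproduct `Δ_L` -/
  antipode_left : ∀ (h : H) (x : H ⊗[k] H), bmk _ _ x = left.Δ h →
    LinearMap.mul' k H (TensorProduct.map S.toLinearMap LinearMap.id x) = right.s (right.ε h)
  /-- `h₁ S(h₂) = s_L (ε_L h)` for the coproduct `Δ_R` -/
  antipode_right : ∀ (h : H) (x : H ⊗[k] H), bmk _ _ x = right.Δ h →
    LinearMap.mul' k H (TensorProduct.map LinearMap.id S.toLinearMap x) = left.s (left.ε h)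

end Bialgebroids

namespace HopfAlgebroid

variable {k : Type u} [CommRing k] {L R : Type v} [Ring L] [Algebra k L] [Ring R] [Algebra k R]
  {H : Type w} [Ring H] [Algebra k H]

/-- A Hopf algebroid is commutative if its underlying algebra and its base algebras are. -/
def IsCommutative (_𝓗 : HopfAlgebroid k L R H) : Prop :=
  (∀ h h' : H, h * h' = h' * h) ∧ (∀ l l' : L, l * l' = l' * l) ∧ (∀ r r' : R, r * r' = r' * r)

/-- The four module structures given by the sources and the targets are finitely generated
projective. -/
def IsFGProjective (𝓗 : HopfAlgebroid k L R H) : Prop :=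
  _root_.IsFGProjective (lmulAct 𝓗.left.s) ∧ _root_.IsFGProjective (lmulAct 𝓗.left.t) ∧
    _root_.IsFGProjective (rmulAct 𝓗.right.s) ∧ _root_.IsFGProjective (rmulActOp 𝓗.right.t)

/-- `𝓗` is the Hopf algebroid `C(G, A)` of functions on the finite group `G` with values in `A`:
pointwise multiplication, sources and targets the constant functions, `ε f = f 1`,
`(S f)(g) = f(g⁻¹)`, `(Δ f)(g, h) = f(gh)`, for both constituent bialgebroids. The last condition
determines `Δ f`, since `C(G, A) ⊗_A C(G, A) = C(G × G, A)` through
`p ⊗ q ↦ ((g, h) ↦ p(g) q(h))`. -/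
structure IsFunctionAlgebra {A : Type v} [Ring A] [Algebra k A] {G : Type x} [Group G] [Finite G]
    (𝓗 : HopfAlgebroid k A A (G → A)) : Prop where
  left_source : ∀ (a : A) (g : G), 𝓗.left.s a g = a
  left_target : ∀ (a : A) (g : G), 𝓗.left.t (op a) g = a
  right_source : ∀ (a : A) (g : G), 𝓗.right.s a g = a
  right_target : ∀ (a : A) (g : G), 𝓗.right.t (op a) g = a
  left_counit : ∀ f : G → A, 𝓗.left.ε f = f 1
  right_counit : ∀ f : G → A, 𝓗.right.ε f = f 1
  antipode : ∀ (f : G → A) (g : G), 𝓗.S f g = f g⁻¹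
  left_comul : ∀ (f : G → A) (x : (G → A) ⊗[k] (G → A)), bmk _ _ x = 𝓗.left.Δ f → ∀ g h : G,
    LinearMap.mul' k A (TensorProduct.map (LinearMap.proj g) (LinearMap.proj h) x) = f (g * h)
  right_comul : ∀ (f : G → A) (x : (G → A) ⊗[k] (G → A)), bmk _ _ x = 𝓗.right.Δ f → ∀ g h : G,
    LinearMap.mul' k A (TensorProduct.map (LinearMap.proj g) (LinearMap.proj h) x) = f (g * h)

end HopfAlgebroid

/-! ### Comodules, comodule algebras, Galois extensions, coverings -/

section Coverings

variable {k : Type u} [CommRing k] {L R : Type v} [Ring L] [Algebra k L] [Ring R] [Algebra k R]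
  {H : Type w} [Ring H] [Algebra k H]

/-- Right comodules over a Hopf algebroid. -/
structure RightComodule (𝓗 : HopfAlgebroid k L R H) (M : Type x) [AddCommGroup M]
    [Module k M] where
  /-- the right `L`-module structure -/
  actL : Lᵐᵒᵖ →ₐ[k] Module.End k M
  /-- the right `R`-module structure -/
  actR : Rᵐᵒᵖ →ₐ[k] Module.End k M
  /-- the coaction `M → M ⊗_L H` of the left bialgebroid -/
  ρL : M →ₗ[k] BalTensor actL (lmulAct 𝓗.left.s)
  /-- the coaction `M → M ⊗_R H` of the right bialgebroid -/
  ρR : M →ₗ[k] BalTensor actR (rmulActOp 𝓗.right.t)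
  /-- Both coactions are right `L`-linear and right `R`-linear. -/
  ρL_L : ∀ (l : L) (m : M) (x : M ⊗[k] H), bmk _ _ x = ρL m →
    ρL (actL (op l) m) = bmk _ _ ((LinearMap.mulLeft k (𝓗.left.t (op l))).lTensor M x)
  ρL_R : ∀ (r : R) (m : M) (x : M ⊗[k] H), bmk _ _ x = ρL m →
    ρL (actR (op r) m) = bmk _ _ ((LinearMap.mulRight k (𝓗.right.s r)).lTensor M x)
  ρR_L : ∀ (l : L) (m : M) (x : M ⊗[k] H), bmk _ _ x = ρR m →
    ρR (actL (op l) m) = bmk _ _ ((LinearMap.mulLeft k (𝓗.left.t (op l))).lTensor M x)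
  ρR_R : ∀ (r : R) (m : M) (x : M ⊗[k] H), bmk _ _ x = ρR m →
    ρR (actR (op r) m) = bmk _ _ ((LinearMap.mulRight k (𝓗.right.s r)).lTensor M x)
  /-- counit axioms `m₀ · ε(m₁) = m` -/
  counit_L : ∀ (m : M) (x : M ⊗[k] H), bmk _ _ x = ρL m →
    TensorProduct.lift actL.toLinearMap.flip
      (((opLinearEquiv k).toLinearMap ∘ₗ 𝓗.left.ε).lTensor M x) = m
  counit_R : ∀ (m : M) (x : M ⊗[k] H), bmk _ _ x = ρR m →
    TensorProduct.lift actR.toLinearMap.flip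
      (((opLinearEquiv k).toLinearMap ∘ₗ 𝓗.right.ε).lTensor M x) = m
  /-- coassociativity of each coaction -/
  coassoc_L : ∀ (m : M) (x : M ⊗[k] H), bmk _ _ x = ρL m →
    (extLeft ρL x : BalTensor₃ actL (lmulAct 𝓗.left.s) (lmulAct 𝓗.left.t) (lmulAct 𝓗.left.s)) =
      extRight 𝓗.left.Δ x
  coassoc_R : ∀ (m : M) (x : M ⊗[k] H), bmk _ _ x = ρR m →
    (extLeft ρR x : BalTensor₃ actR (rmulActOp 𝓗.right.t) (rmulAct 𝓗.right.s)
      (rmulActOp 𝓗.right.t)) = extRight 𝓗.right.Δ x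
  /-- `(ρ_R ⊗_L id) ρ_L = (id ⊗_R Δ_L) ρ_R`, in `M ⊗_R H ⊗_L H` -/
  mixed_RL : ∀ (m : M) (x y : M ⊗[k] H), bmk _ _ x = ρL m → bmk _ _ y = ρR m →
    (extLeft ρR x : BalTensor₃ actR (rmulActOp 𝓗.right.t) (lmulAct 𝓗.left.t)
      (lmulAct 𝓗.left.s)) = extRight 𝓗.left.Δ y
  /-- `(ρ_L ⊗_R id) ρ_R = (id ⊗_L Δ_R) ρ_L`, in `M ⊗_L H ⊗_R H` -/
  mixed_LR : ∀ (m : M) (x y : M ⊗[k] H), bmk _ _ x = ρL m → bmk _ _ y = ρR m →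
    (extLeft ρL y : BalTensor₃ actL (lmulAct 𝓗.left.s) (rmulAct 𝓗.right.s)
      (rmulActOp 𝓗.right.t)) = extRight 𝓗.right.Δ x

/-- Right comodule algebras over a Hopf algebroid: an `R`-ring `R → B` which is a right comodule,
such that unit and multiplication are comodule maps. -/
structure ComoduleAlgebra (𝓗 : HopfAlgebroid k L R H) (B : Type x) [Ring B] [Algebra k B]
    extends RightComodule 𝓗 B where
  /-- the unit of the `R`-ring `B` -/
  η : R →ₐ[k] B
  /-- The right `R`-module structure of the comodule is that of the `R`-ring. -/
  actR_eq : actR = rmulAct η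
  ρL_one : ρL 1 = bmk _ _ (1 ⊗ₜ[k] 1)
  ρR_one : ρR 1 = bmk _ _ (1 ⊗ₜ[k] 1)
  ρL_mul : ∀ (m n : B) (x y : B ⊗[k] H), bmk _ _ x = ρL m → bmk _ _ y = ρL n →
    ρL (m * n) = bmk _ _ (x * y)
  ρR_mul : ∀ (m n : B) (x y : B ⊗[k] H), bmk _ _ x = ρR m → bmk _ _ y = ρR n →
    ρR (m * n) = bmk _ _ (x * y)

/-- `A ⊆ B` is an `𝓗`-Galois extension: `A` is the set of coinvariants of either coaction, and the
Galois maps `B ⊗_A B → B ⊗_R H`, `a ⊗ b ↦ a b₀ ⊗ b₁` and `B ⊗_A B → B ⊗_L H`,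
`a ⊗ b ↦ a₀ b ⊗ a₁` are (well-defined and) bijective. -/
structure ComoduleAlgebra.IsGalois {𝓗 : HopfAlgebroid k L R H} {B : Type x} [Ring B] [Algebra k B]
    (ρ : ComoduleAlgebra 𝓗 B) (A : Subalgebra k B) : Prop where
  coinvariants_R : ∀ b : B, ρ.ρR b = bmk _ _ (b ⊗ₜ[k] 1) ↔ b ∈ A
  coinvariants_L : ∀ b : B, ρ.ρL b = bmk _ _ (b ⊗ₜ[k] 1) ↔ b ∈ A
  gal_R : ∃ gal : BalTensor (rmulAct A.val) (lmulAct A.val) ≃ₗ[k]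
      BalTensor ρ.actR (rmulActOp 𝓗.right.t),
    ∀ (a b : B) (x : B ⊗[k] H), bmk _ _ x = ρ.ρR b →
      gal (bmk _ _ (a ⊗ₜ[k] b)) = bmk _ _ ((a ⊗ₜ[k] 1) * x)
  gal_L : ∃ gal : BalTensor (rmulAct A.val) (lmulAct A.val) ≃ₗ[k]
      BalTensor ρ.actL (lmulAct 𝓗.left.s),
    ∀ (a b : B) (x : B ⊗[k] H), bmk _ _ x = ρ.ρL a →
      gal (bmk _ _ (a ⊗ₜ[k] b)) = bmk _ _ (x * (b ⊗ₜ[k] 1))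

/-- (Finite, Galois) noncommutative coverings `(B, 𝓗)` of the subalgebra `A` of `B`, where `𝓗` is a
Hopf algebroid over the subalgebra `A'` of `A`. -/
structure NCCovering {B : Type x} [Ring B] [Algebra k B] (A A' : Subalgebra k B)
    {L : Type x} [Ring L] [Algebra k L] {H : Type w} [Ring H] [Algebra k H]
    (𝓗 : HopfAlgebroid k L A' H) where
  base_le : A' ≤ A
  hopf_fgProjective : 𝓗.IsFGProjective
  /-- the coaction of `𝓗` on `B` -/
  coaction : ComoduleAlgebra 𝓗 B
  /-- The `A'`-ring structure of `B` is the inclusion. -/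
  unit_eq : coaction.η = A'.val
  galois : coaction.IsGalois A
  left_fgProjective : IsFGProjective (lmulAct A.val)
  right_fgProjective : IsFGProjective (rmulAct A.val)

/-- Local coverings of `A`: the Hopf algebroid is over `A' = A`. -/
abbrev LocalNCCovering {B : Type x} [Ring B] [Algebra k B] (A : Subalgebra k B)
    {L : Type x} [Ring L] [Algebra k L] {H : Type w} [Ring H] [Algebra k H]
    (𝓗 : HopfAlgebroid k L A H) :=
  NCCovering A A 𝓗

end Coverings

/-! ### Noncommutative tori -/

namespace NCTorus

/-- A pair of unitaries with `u v = e^{2πiθ} v u` in a nonzero unital C⋆-algebra. -/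
structure Pair (θ : ℝ) : Type 1 where
  /-- the C⋆-algebra -/
  alg : Type
  [cstar : CStarAlgebra alg]
  [nontriv : Nontrivial alg]
  /-- the first unitary -/
  u : alg
  /-- the second unitary -/
  v : alg
  hu : u ∈ unitary alg
  hv : v ∈ unitary alg
  comm : u * v = Complex.exp (2 * Real.pi * Complex.I * θ) • (v * u)

attribute [instance] Pair.cstar Pair.nontriv

/-- The C⋆-algebra of bounded families, indexed by all pairs, with the supremum norm. -/
abbrev Bounded (θ : ℝ) : Type 1 := lp (fun p : Pair θ => p.alg) ∞

noncomputable instance (θ : ℝ) : CStarAlgebra (Bounded θ) where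

/-- The bounded family of all first unitaries. -/
noncomputable def univU (θ : ℝ) : Bounded θ :=
  ⟨fun p => p.u, memℓp_infty ⟨1, by
    rintro _ ⟨p, rfl⟩
    exact (CStarRing.norm_of_mem_unitary p.hu).le⟩⟩

/-- The bounded family of all second unitaries. -/
noncomputable def univV (θ : ℝ) : Bounded θ :=
  ⟨fun p => p.v, memℓp_infty ⟨1, by
    rintro _ ⟨p, rfl⟩
    exact (CStarRing.norm_of_mem_unitary p.hv).le⟩⟩

/-- The C⋆-subalgebra generated by the two families. -/
noncomputable def sub (θ : ℝ) : StarSubalgebra ℂ (Bounded θ) :=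
  (StarAlgebra.adjoin ℂ {univU θ, univV θ}).topologicalClosure

instance (θ : ℝ) : IsClosed (sub θ : Set (Bounded θ)) :=
  StarSubalgebra.isClosed_topologicalClosure _

end NCTorus

/-- The noncommutative torus `𝕋²_θ`: the universal C⋆-algebra generated by unitaries `U`, `V` with
`U V = e^{2πiθ} V U`, built as the C⋆-algebra generated by the family of all pairs of such
unitaries. -/
def NCTorus (θ : ℝ) : Type 1 := NCTorus.sub θ

namespace NCTorus

noncomputable instance (θ : ℝ) : CStarAlgebra (NCTorus θ) :=
  inferInstanceAs (CStarAlgebra (NCTorus.sub θ))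

/-- The generator `U`. -/
noncomputable def U (θ : ℝ) : NCTorus θ :=
  ⟨univU θ, StarSubalgebra.le_topologicalClosure _
    (StarAlgebra.subset_adjoin ℂ _ (Set.mem_insert _ _))⟩

/-- The generator `V`. -/
noncomputable def V (θ : ℝ) : NCTorus θ :=
  ⟨univV θ, StarSubalgebra.le_topologicalClosure _
    (StarAlgebra.subset_adjoin ℂ _ (Set.mem_insert_of_mem _ rfl))⟩


/-- The inclusion into the algebra of bounded families. -/
noncomputable def incl (θ : ℝ) : NCTorus θ →⋆ₐ[ℂ] Bounded θ := (sub θ).subtype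

/-- The component of a bounded family at a given pair. -/
noncomputable def proj (θ : ℝ) (p : Pair θ) : Bounded θ →⋆ₐ[ℂ] p.alg where
  toFun f := f p
  map_one' := rfl
  map_mul' _ _ := rfl
  map_zero' := rfl
  map_add' _ _ := rfl
  commutes' _ := rfl
  map_star' _ := rfl

theorem U_mem_unitary (θ : ℝ) : U θ ∈ unitary (NCTorus θ) := by
  refine Unitary.mem_iff.2 ⟨Subtype.ext (Subtype.ext (funext fun p => ?_)),
    Subtype.ext (Subtype.ext (funext fun p => ?_))⟩
  · exact (Unitary.mem_iff.1 p.hu).1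
  · exact (Unitary.mem_iff.1 p.hu).2

theorem V_mem_unitary (θ : ℝ) : V θ ∈ unitary (NCTorus θ) := by
  refine Unitary.mem_iff.2 ⟨Subtype.ext (Subtype.ext (funext fun p => ?_)),
    Subtype.ext (Subtype.ext (funext fun p => ?_))⟩
  · exact (Unitary.mem_iff.1 p.hv).1
  · exact (Unitary.mem_iff.1 p.hv).2

theorem U_mul_V (θ : ℝ) :
    U θ * V θ = Complex.exp (2 * Real.pi * Complex.I * θ) • (V θ * U θ) :=
  Subtype.ext (Subtype.ext (funext fun p => p.comm))

open scoped CStarAlgebra in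
/-- The universal property. (A C⋆-algebra generated by two elements has at most continuum many
elements, so the restriction to C⋆-algebras in `Type` is immaterial.) -/
theorem existsUnique_lift (θ : ℝ) {C : Type} [CStarAlgebra C] (u v : C) (hu : u ∈ unitary C)
    (hv : v ∈ unitary C) (huv : u * v = Complex.exp (2 * Real.pi * Complex.I * θ) • (v * u)) :
    ∃! φ : NCTorus θ →⋆ₐ[ℂ] C, φ (U θ) = u ∧ φ (V θ) = v := by
  rcases subsingleton_or_nontrivial C with hC | hC
  · refine ⟨{ toFun := fun _ => 0, map_one' := Subsingleton.elim _ _,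
              map_mul' := fun _ _ => Subsingleton.elim _ _, map_zero' := rfl,
              map_add' := fun _ _ => Subsingleton.elim _ _,
              commutes' := fun _ => Subsingleton.elim _ _,
              map_star' := fun _ => Subsingleton.elim _ _ },
      ⟨Subsingleton.elim _ _, Subsingleton.elim _ _⟩,
      fun ψ _ => StarAlgHom.ext fun _ => Subsingleton.elim _ _⟩
  · let p : Pair θ := ⟨C, u, v, hu, hv, huv⟩
    refine ⟨(proj θ p).comp (incl θ), ⟨rfl, rfl⟩, fun ψ hψ => ?_⟩
    have key : ∀ φ χ : sub θ →⋆ₐ[ℂ] C, Continuous φ → Continuous χ →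
        φ (U θ) = χ (U θ) → φ (V θ) = χ (V θ) → φ = χ := by
      intro φ χ hφ hχ h1 h2
      refine StarAlgHom.ext_topologicalClosure hφ hχ ?_
      refine StarAlgHom.ext_adjoin ?_
      rintro ⟨x, hx⟩ hx'
      rcases hx' with rfl | hx'
      · exact h1
      · have : x = univV θ := hx'
        subst this
        exact h2
    have h1 : Continuous ψ := map_continuous ψ
    have h2 : Continuous ((proj θ p).comp (incl θ)) := map_continuous _
    exact key ψ _ h1 h2 hψ.1 hψ.2

end NCTorus

/-! ### Centres and the commutative torus -/

/-- The centre of a C⋆-algebra, as a star subalgebra. -/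
def starCenter (B : Type u) [CStarAlgebra B] : StarSubalgebra ℂ B where
  toSubalgebra := Subalgebra.center ℂ B
  star_mem' := fun h => Set.star_mem_center h

/-- The coordinate functions of the commutative torus `𝕋² = S¹ × S¹`. -/
def torusCoord₁ : C(Circle × Circle, ℂ) := ⟨fun z => (z.1 : ℂ), by fun_prop⟩

/-- The coordinate functions of the commutative torus `𝕋² = S¹ × S¹`. -/
def torusCoord₂ : C(Circle × Circle, ℂ) := ⟨fun z => (z.2 : ℂ), by fun_prop⟩

/-! Write `B` for the torus, `A` for its centre, `G = ℤ/m × ℤ/m` and `z = e^{2πiθ}`, a primitive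
`m`-th root of unity because `n` and `m` are coprime. Conjugation by `U` fixes `U` and multiplies
`V` by `z`; conjugation by `V` fixes `V` and multiplies `U` by `z⁻¹`. These automorphisms commute
and their `m`-th powers are trivial, so they define an action of `G` on `B`. An element fixed by `G`
commutes with `U` and `V`, hence is central: `A` is the fixed algebra
(`RotationPair.mem_center_iff`).

For any action of a finite group `G` with central fixed algebra `A`, the algebra `B` is a comodule
algebra over `C(G, A)`. Since `M ⊗_A C(G, A) = C(G, M)` (`balEquiv`), the axioms become pointwise
identities, and all forms of coassociativity reduce to `σ_g σ_h = σ_{gh}` (`coact_coassoc`).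
Bijectivity of the Galois maps and projectivity of `B` both follow from elements `x_i`, `y_i` with
`∑ x_i σ_g(y_i) = δ_{g,1}` (`IsGaloisCoordinates`). Here the monomials `U^i V^j` with `0 ≤ i, j < m`
are eigenvectors of `G` for all of its characters, so by orthogonality one may take them as the
`y_i`, with `x_i = m⁻² y_i⁻¹`.

For the structure of the centre, the average over `G` is continuous, fixes `A` and kills `U^i V^j`
unless `m` divides both exponents. So `A` is generated as a C⋆-algebra by `U^m` and `V^m`
(`NCTorus.starCenter_le`), and a character of `A` is a point of `𝕋²`. Every point occurs: clock and
shift matrices represent `B` with `U^m` and `V^m` acting by prescribed scalars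
(`NCTorus.exists_character`). Gelfand duality then gives `A ≅ C(𝕋²)`. -/

/-! ### Balanced tensor products with function algebras -/

section FunctionTensor

variable {k : Type*} [CommRing k] {R : Type*} [Ring R] [Algebra k R]
variable {M : Type*} [AddCommGroup M] [Module k M] {G : Type*}

/-- The map `M ⊗ C(G, R) → C(G, M)`, `m ⊗ f ↦ (g ↦ m · f g)`. -/
noncomputable def evalCoord (G : Type*) (a : Rᵐᵒᵖ →ₐ[k] Module.End k M) :
    M ⊗[k] (G → R) →ₗ[k] (G → M) :=
  LinearMap.pi fun g => TensorProduct.lift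
    (a.toLinearMap ∘ₗ (opLinearEquiv k).toLinearMap ∘ₗ LinearMap.proj g).flip

@[simp] theorem evalCoord_tmul (a : Rᵐᵒᵖ →ₐ[k] Module.End k M) (m : M) (f : G → R) (g : G) :
    evalCoord G a (m ⊗ₜ f) g = a (op (f g)) m := rfl

/-- The map `M ⊗ C(G, R) ⊗ C(G, R) → C(G × G, M)`, `m ⊗ p ⊗ q ↦ ((g, h) ↦ m · p g · q h)`. -/
noncomputable def evalCoord₃ (G : Type*) (a : Rᵐᵒᵖ →ₐ[k] Module.End k M) :
    (M ⊗[k] (G → R)) ⊗[k] (G → R) →ₗ[k] (G → G → M) :=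
  LinearMap.pi fun g => evalCoord G a ∘ₗ (LinearMap.proj g ∘ₗ evalCoord G a).rTensor (G → R)

@[simp] theorem evalCoord₃_tmul (a : Rᵐᵒᵖ →ₐ[k] Module.End k M) (z : M ⊗[k] (G → R)) (f : G → R)
    (g h : G) : evalCoord₃ G a (z ⊗ₜ f) g h = a (op (f h)) (evalCoord G a z g) := rfl

variable (a : Rᵐᵒᵖ →ₐ[k] Module.End k M) (b : R →ₐ[k] Module.End k (G → R))
  (c : Rᵐᵒᵖ →ₐ[k] Module.End k (G → R)) (d : R →ₐ[k] Module.End k (G → R))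

theorem act_op_mul (r s : R) (m : M) : a (op (r * s)) m = a (op s) (a (op r) m) := by
  rw [op_mul, map_mul, Module.End.mul_apply]

theorem balRel_le_ker_evalCoord (hb : ∀ r f g, b r f g = r * f g) :
    balRel a b ≤ LinearMap.ker (evalCoord G a) := by
  refine Submodule.span_le.2 ?_
  rintro _ ⟨r, m, f, rfl⟩
  rw [SetLike.mem_coe, LinearMap.mem_ker, map_sub, sub_eq_zero]
  ext g
  simp [hb]

theorem balRel₃_le_ker_evalCoord₃ (hb : ∀ r f g, b r f g = r * f g)
    (hc : ∀ r f g, c (op r) f g = f g * r) (hd : ∀ r f g, d r f g = r * f g) :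
    balRel₃ a b c d ≤ LinearMap.ker (evalCoord₃ G a) := by
  refine Submodule.span_le.2 ?_
  rintro _ (⟨r, m, f, p, rfl⟩ | ⟨r, m, f, p, rfl⟩)
  · rw [SetLike.mem_coe, LinearMap.mem_ker, map_sub, sub_eq_zero]
    ext g h
    simp [hb]
  · rw [SetLike.mem_coe, LinearMap.mem_ker, map_sub, sub_eq_zero]
    ext g h
    simp [hc, hd]

variable {a b c d}

theorem bmk_act (r : R) (m : M) (f : G → R) :
    bmk a b (a (op r) m ⊗ₜ f) = bmk a b (m ⊗ₜ b r f) :=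
  (Submodule.Quotient.eq _).2 (Submodule.subset_span ⟨r, m, f, rfl⟩)

theorem mkQ₃_act_left (r : R) (m : M) (f p : G → R) :
    (balRel₃ a b c d).mkQ ((a (op r) m ⊗ₜ f) ⊗ₜ p) =
      (balRel₃ a b c d).mkQ ((m ⊗ₜ b r f) ⊗ₜ p) :=
  (Submodule.Quotient.eq _).2 (Submodule.subset_span (Or.inl ⟨r, m, f, p, rfl⟩))

theorem mkQ₃_act_right (r : R) (m : M) (f p : G → R) :
    (balRel₃ a b c d).mkQ ((m ⊗ₜ c (op r) f) ⊗ₜ p) =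
      (balRel₃ a b c d).mkQ ((m ⊗ₜ f) ⊗ₜ d r p) :=
  (Submodule.Quotient.eq _).2 (Submodule.subset_span (Or.inr ⟨r, m, f, p, rfl⟩))

variable [Fintype G] [DecidableEq G]

theorem sum_const_mul_single (hb : ∀ r f g, b r f g = r * f g) (f : G → R) :
    ∑ g, b (f g) (Pi.single g 1) = f := by
  ext h
  simp [Finset.sum_apply, hb, Pi.single_apply]

/-- The balanced tensor product `M ⊗_R C(G, R)` is `C(G, M)`. -/
noncomputable def balEquiv (a : Rᵐᵒᵖ →ₐ[k] Module.End k M) (b : R →ₐ[k] Module.End k (G → R))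
    (hb : ∀ r f g, b r f g = r * f g) : BalTensor a b ≃ₗ[k] (G → M) :=
  LinearEquiv.ofLinearMap
    ((balRel a b).liftQ (evalCoord G a) (balRel_le_ker_evalCoord a b hb))
    -- The inverse is `F ↦ ∑ g, F g ⊗ δ_g`: the indicator functions `δ_g` are a basis of `C(G, R)`
    -- over `R`.
    (bmk a b ∘ₗ ∑ g, (TensorProduct.mk k M (G → R)).flip (Pi.single g 1) ∘ₗ LinearMap.proj g)
    (by
      refine LinearMap.ext fun F => funext fun h => ?_
      have key : ∀ g, a (op ((Pi.single g 1 : G → R) h)) (F g) = if g = h then F h else 0 := by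
        intro g
        rcases eq_or_ne g h with rfl | hgh
        · simp
        · simp [hgh]
      simp [Finset.sum_apply, key])
    (by
      refine Submodule.linearMap_qext _ (TensorProduct.ext' fun m f => ?_)
      calc _ = bmk a b (∑ g, a (op (f g)) m ⊗ₜ[k] (Pi.single g 1 : G → R)) := by
            simp
        _ = ∑ g, bmk a b (m ⊗ₜ b (f g) (Pi.single g 1)) := by
            rw [map_sum]; exact Finset.sum_congr rfl fun g _ => bmk_act _ _ _
        _ = bmk a b (m ⊗ₜ f) := by
            rw [← map_sum, ← TensorProduct.tmul_sum, sum_const_mul_single hb])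

@[simp] theorem balEquiv_bmk (hb : ∀ r f g, b r f g = r * f g) (x : M ⊗[k] (G → R)) :
    balEquiv a b hb (bmk a b x) = evalCoord G a x := rfl

theorem bmk_eq_iff (hb : ∀ r f g, b r f g = r * f g) (x y : M ⊗[k] (G → R)) :
    bmk a b x = bmk a b y ↔ evalCoord G a x = evalCoord G a y :=
  (balEquiv a b hb).injective.eq_iff.symm

theorem bmk_eq_symm_iff (hb : ∀ r f g, b r f g = r * f g) (x : M ⊗[k] (G → R)) (F : G → M) :
    bmk a b x = (balEquiv a b hb).symm F ↔ evalCoord G a x = F := by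
  rw [LinearEquiv.eq_symm_apply, balEquiv_bmk]

theorem symm_eq_bmk_iff (hb : ∀ r f g, b r f g = r * f g) (x : M ⊗[k] (G → R)) (F : G → M) :
    (balEquiv a b hb).symm F = bmk a b x ↔ F = evalCoord G a x := by
  rw [LinearEquiv.symm_apply_eq, balEquiv_bmk]

/-- The map `M ⊗_R C(G, R) ⊗_R C(G, R) → C(G × G, M)`. -/
noncomputable def balEval₃ (a : Rᵐᵒᵖ →ₐ[k] Module.End k M) (b : R →ₐ[k] Module.End k (G → R))
    (c : Rᵐᵒᵖ →ₐ[k] Module.End k (G → R)) (d : R →ₐ[k] Module.End k (G → R))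
    (hb : ∀ r f g, b r f g = r * f g) (hc : ∀ r f g, c (op r) f g = f g * r)
    (hd : ∀ r f g, d r f g = r * f g) : BalTensor₃ a b c d →ₗ[k] (G → G → M) :=
  (balRel₃ a b c d).liftQ (evalCoord₃ G a) (balRel₃_le_ker_evalCoord₃ a b c d hb hc hd)

/-- The indicator functions on both function legs supply a left inverse. Injectivity is all that is
needed, since the map serves only to test equations in the triple tensor product pointwise. -/
theorem balEval₃_injective (hb : ∀ r f g, b r f g = r * f g)
    (hc : ∀ r f g, c (op r) f g = f g * r) (hd : ∀ r f g, d r f g = r * f g) :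
    Function.Injective (balEval₃ a b c d hb hc hd) := by
  let sec : (G → G → M) →ₗ[k] BalTensor₃ a b c d :=
    ∑ g, ∑ h, (balRel₃ a b c d).mkQ ∘ₗ
      (TensorProduct.mk k (M ⊗[k] (G → R)) (G → R)).flip (Pi.single h 1) ∘ₗ
      (TensorProduct.mk k M (G → R)).flip (Pi.single g 1) ∘ₗ LinearMap.proj h ∘ₗ LinearMap.proj g
  have hsec : sec ∘ₗ balEval₃ a b c d hb hc hd = LinearMap.id := by
    refine Submodule.linearMap_qext _ (TensorProduct.ext_threefold fun m f p => ?_)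
    -- The values `0` and `1` of an indicator function are central, so `s` can pass to its right
    -- side even when `R` is not commutative.
    have hbc : ∀ r s g, b (r * s) (Pi.single g 1) = c (op s) (b r (Pi.single g 1)) := by
      intro r s g
      ext h
      rw [hb, hc, hb]
      rcases eq_or_ne h g with rfl | hgh
      · simp
      · simp [Pi.single_eq_of_ne hgh]
    calc _ = ∑ g, ∑ h, (balRel₃ a b c d).mkQ
          ((a (op (p h)) (a (op (f g)) m) ⊗ₜ[k] (Pi.single g 1 : G → R)) ⊗ₜ[k]
            (Pi.single h 1 : G → R)) := by
          simp only [sec, LinearMap.comp_apply, LinearMap.sum_apply]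
          rfl
      _ = ∑ g, ∑ h, (balRel₃ a b c d).mkQ
          ((m ⊗ₜ[k] b (f g) (Pi.single g 1)) ⊗ₜ[k] d (p h) (Pi.single h 1)) := by
          refine Finset.sum_congr rfl fun g _ => Finset.sum_congr rfl fun h _ => ?_
          rw [← act_op_mul, mkQ₃_act_left, hbc, mkQ₃_act_right]
      _ = _ := by
          simp only [← map_sum, ← TensorProduct.tmul_sum, ← TensorProduct.sum_tmul]
          rw [sum_const_mul_single hd, sum_const_mul_single hb]
          rfl
  exact Function.LeftInverse.injective (g := sec) fun z => LinearMap.congr_fun hsec z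

theorem balEval₃_joinLeft (hb : ∀ r f g, b r f g = r * f g)
    (hc : ∀ r f g, c (op r) f g = f g * r) (hd : ∀ r f g, d r f g = r * f g)
    (z : BalTensor a b) (p : G → R) (g h : G) :
    balEval₃ a b c d hb hc hd (joinLeft a b c d (z ⊗ₜ p)) g h =
      a (op (p h)) (balEquiv a b hb z g) := by
  obtain ⟨y, rfl⟩ := Submodule.mkQ_surjective _ z
  rfl

/-- The arguments `h g` of `balEquiv` are reversed because its outer index evaluates the second
tensor leg, while `g` belongs to the first. -/
theorem balEval₃_joinRight (hb : ∀ r f g, b r f g = r * f g)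
    (hc : ∀ r f g, c (op r) f g = f g * r) (hd : ∀ r f g, d r f g = r * f g)
    (m : M) (z : BalTensor c d) (g h : G) :
    balEval₃ a b c d hb hc hd (joinRight a b c d (m ⊗ₜ z)) g h =
      a (op (balEquiv c d hd z h g)) m := by
  obtain ⟨y, rfl⟩ := Submodule.mkQ_surjective _ z
  induction y using TensorProduct.induction_on with
  | zero => simp
  | add y y' hy hy' =>
    simp only [map_add, TensorProduct.tmul_add, Pi.add_apply, hy, hy', op_add,
      LinearMap.add_apply]
  | tmul f p =>
    have h1 : balEquiv c d hd ((balRel c d).mkQ (f ⊗ₜ p)) h g = f g * p h := by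
      rw [balEquiv_bmk, evalCoord_tmul, hc]
    rw [h1, act_op_mul]
    rfl

/-- Two iterated maps into a triple tensor product agree if they agree at all points. -/
theorem extLeft_eq_extRight {Q Q' : Type*} [AddCommGroup Q] [Module k Q] [AddCommGroup Q']
    [Module k Q']
    (hb : ∀ r f g, b r f g = r * f g)
    (hc : ∀ r f g, c (op r) f g = f g * r) (hd : ∀ r f g, d r f g = r * f g)
    (φ : Q →ₗ[k] BalTensor a b) (ψ : Q' →ₗ[k] BalTensor c d) (x : Q ⊗[k] (G → R)) (y : M ⊗[k] Q')
    (h : ∀ g h, (TensorProduct.lift (a.toLinearMap ∘ₗ (opLinearEquiv k).toLinearMap ∘ₗ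
        LinearMap.proj h).flip)
          ((LinearMap.proj g ∘ₗ (balEquiv a b hb).toLinearMap ∘ₗ φ).rTensor _ x) =
      (TensorProduct.lift (a.toLinearMap ∘ₗ (opLinearEquiv k).toLinearMap ∘ₗ
        LinearMap.proj g ∘ₗ LinearMap.proj h ∘ₗ (balEquiv c d hd).toLinearMap ∘ₗ ψ).flip) y) :
    (extLeft φ x : BalTensor₃ a b c d) = extRight ψ y := by
  refine balEval₃_injective hb hc hd (funext fun g => funext fun h' => ?_)
  have hl : ∀ x, balEval₃ a b c d hb hc hd (extLeft φ x) g h' =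
      (TensorProduct.lift (a.toLinearMap ∘ₗ (opLinearEquiv k).toLinearMap ∘ₗ
        LinearMap.proj h').flip)
          ((LinearMap.proj g ∘ₗ (balEquiv a b hb).toLinearMap ∘ₗ φ).rTensor _ x) := by
    intro x
    induction x using TensorProduct.induction_on with
    | zero => simp
    | add x y hx hy => simp only [map_add, Pi.add_apply, hx, hy]
    | tmul q p => exact balEval₃_joinLeft hb hc hd (φ q) p g h'
  have hr : ∀ y, balEval₃ a b c d hb hc hd (extRight ψ y) g h' =
      (TensorProduct.lift (a.toLinearMap ∘ₗ (opLinearEquiv k).toLinearMap ∘ₗ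
        LinearMap.proj g ∘ₗ LinearMap.proj h' ∘ₗ (balEquiv c d hd).toLinearMap ∘ₗ ψ).flip) y := by
    intro y
    induction y using TensorProduct.induction_on with
    | zero => simp
    | add x y hx hy => simp only [map_add, Pi.add_apply, hx, hy]
    | tmul m q => exact balEval₃_joinRight hb hc hd m (ψ q) g h'
  rw [hl, hr, h]

end FunctionTensor

/-! ### Group actions as coactions of function algebras -/

section Coaction

variable {k : Type*} [CommRing k] {R : Type*} [Ring R] [Algebra k R]
variable {M : Type*} [AddCommGroup M] [Module k M] {G : Type*}

/-- If the action of `R` is compatible with a product of `M`, then `M ⊗ C(G, R) → C(G, M)` is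
multiplicative. -/
theorem evalCoord_mul {B : Type*} [Ring B] [Algebra k B] {a : Rᵐᵒᵖ →ₐ[k] Module.End k B}
    (hl : ∀ r m n, a (op r) (m * n) = a (op r) m * n)
    (hr : ∀ r m n, a (op r) (m * n) = m * a (op r) n) (x y : B ⊗[k] (G → R)) :
    evalCoord G a (x * y) = evalCoord G a x * evalCoord G a y := by
  induction x using TensorProduct.induction_on with
  | zero => simp
  | add x x' hx hx' => simp only [add_mul, map_add, hx, hx']
  | tmul m f =>
    induction y using TensorProduct.induction_on with
    | zero => simp
    | add y y' hy hy' => simp only [mul_add, map_add, hy, hy']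
    | tmul n p =>
      ext g
      rw [Algebra.TensorProduct.tmul_mul_tmul, evalCoord_tmul, Pi.mul_apply, Pi.mul_apply,
        act_op_mul, hl, hr, evalCoord_tmul, evalCoord_tmul]

/-- The action of `G` on functions by right translations. -/
def rightTranslation (k G R : Type*) [CommRing k] [Ring R] [Algebra k R] [Group G] :
    G →* Module.End k (G → R) where
  toFun g := LinearMap.funLeft k R (· * g)
  map_one' := by ext f h; simp
  map_mul' g g' := by
    ext f h
    simp [LinearMap.funLeft_apply, mul_assoc]

@[simp] theorem rightTranslation_apply [Group G] (f : G → R) (g h : G) :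
    rightTranslation k G R g f h = f (h * g) := rfl

variable [Fintype G] [DecidableEq G] [Group G]

/-- The coaction `M → M ⊗_R C(G, R)` of an action of the group `G` on `M`. -/
noncomputable def coact (σ : G →* Module.End k M) (a : Rᵐᵒᵖ →ₐ[k] Module.End k M)
    (b : R →ₐ[k] Module.End k (G → R)) (hb : ∀ r f g, b r f g = r * f g) :
    M →ₗ[k] BalTensor a b :=
  (balEquiv a b hb).symm.toLinearMap ∘ₗ LinearMap.pi fun g => σ g

variable {σ : G →* Module.End k M} {a : Rᵐᵒᵖ →ₐ[k] Module.End k M}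
  {b : R →ₐ[k] Module.End k (G → R)}

theorem bmk_eq_coact_iff (hb : ∀ r f g, b r f g = r * f g) (x : M ⊗[k] (G → R)) (m : M) :
    bmk a b x = coact σ a b hb m ↔ ∀ g, evalCoord G a x g = σ g m :=
  (bmk_eq_symm_iff hb x _).trans funext_iff

theorem coact_eq_bmk_iff (hb : ∀ r f g, b r f g = r * f g) (x : M ⊗[k] (G → R)) (m : M) :
    coact σ a b hb m = bmk a b x ↔ ∀ g, σ g m = evalCoord G a x g :=
  (symm_eq_bmk_iff hb x _).trans funext_iff

@[simp] theorem balEquiv_coact (hb : ∀ r f g, b r f g = r * f g) (m : M) (g : G) :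
    balEquiv a b hb (coact σ a b hb m) g = σ g m := by
  simp [coact]

/-- Coassociativity of the coaction of `C(G, R)` on `M`. -/
theorem coact_coassoc {d : R →ₐ[k] Module.End k (G → R)} {c : Rᵐᵒᵖ →ₐ[k] Module.End k (G → R)}
    {a' : Rᵐᵒᵖ →ₐ[k] Module.End k M}
    (haa : ∀ r m, a r m = a' r m)
    (hb : ∀ r f g, b r f g = r * f g) (hc : ∀ r f g, c (op r) f g = f g * r)
    (hd : ∀ r f g, d r f g = r * f g) (hσ : ∀ g r m, σ g (a (op r) m) = a (op r) (σ g m))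
    (m : M) (x y : M ⊗[k] (G → R))
    (hx : bmk a' d x = coact σ a' d hd m) (hy : bmk a b y = coact σ a b hb m) :
    (extLeft (coact σ a b hb) x : BalTensor₃ a b c d) =
      extRight (coact (rightTranslation k G R) c d hd) y := by
  -- Two names for one action are allowed because the left and the right base actions on `C(G, A)`
  -- agree only through commutativity of `A`.
  obtain rfl : a = a' := AlgHom.ext fun r => LinearMap.ext (haa r)
  rw [bmk_eq_coact_iff] at hx hy
  refine extLeft_eq_extRight hb hc hd _ _ _ _ fun g h => ?_
  -- At `(g, h)` one side is `σ g (σ h m)`, by linearity of `σ g` over `R`, and the other is `σ (g *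
  -- h) m`.
  have h1 : (TensorProduct.lift (a.toLinearMap ∘ₗ (opLinearEquiv k).toLinearMap ∘ₗ
        LinearMap.proj h).flip) ∘ₗ
          ((LinearMap.proj g ∘ₗ (balEquiv a b hb).toLinearMap ∘ₗ coact σ a b hb).rTensor (G → R)) =
      σ g ∘ₗ LinearMap.proj h ∘ₗ evalCoord G a :=
    TensorProduct.ext' fun m f => by simp [hσ]
  have h2 : (TensorProduct.lift (a.toLinearMap ∘ₗ (opLinearEquiv k).toLinearMap ∘ₗ
        LinearMap.proj g ∘ₗ LinearMap.proj h ∘ₗ (balEquiv c d hd).toLinearMap ∘ₗ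
          coact (rightTranslation k G R) c d hd).flip) =
      LinearMap.proj (g * h) ∘ₗ evalCoord G a :=
    TensorProduct.ext' fun m f => by simp
  rw [h2, ← LinearMap.comp_apply, h1]
  simp [hx, hy]

end Coaction

/-! ### The Hopf algebroid of functions on a finite group -/

section FunctionHopfAlgebroid

variable {k : Type u} [CommRing k] {A : Type v} [Ring A] [Algebra k A]
variable {G : Type x}

/-- The inclusion of constant functions, for commutative `A`, as a map on the opposite algebra. -/
def constOp (k : Type u) [CommRing k] [Algebra k A] (G : Type x)
    (hA : ∀ r s : A, r * s = s * r) : Aᵐᵒᵖ →ₐ[k] (G → A) where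
  toFun r _ := r.unop
  map_one' := rfl
  map_mul' _ _ := funext fun _ => hA _ _
  map_zero' := rfl
  map_add' _ _ := rfl
  commutes' _ := rfl

@[simp] theorem constOp_apply (hA : ∀ r s : A, r * s = s * r) (r : Aᵐᵒᵖ) (g : G) :
    constOp k G hA r g = r.unop := rfl

theorem lmulAct_const (r : A) (f : G → A) (g : G) :
    lmulAct (Pi.constAlgHom k G A) r f g = r * f g := rfl

theorem rmulAct_const (r : A) (f : G → A) (g : G) :
    rmulAct (Pi.constAlgHom k G A) (op r) f g = f g * r := rfl

theorem lmulAct_constOp (hA : ∀ r s : A, r * s = s * r) (r : A) (f : G → A) (g : G) :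
    lmulAct (constOp k G hA) (op r) f g = f g * r := hA _ _

theorem rmulActOp_constOp (hA : ∀ r s : A, r * s = s * r) (r : A) (f : G → A) (g : G) :
    rmulActOp (constOp k G hA) r f g = r * f g := hA _ _

theorem evalCoord_mul_of_pointwise (hA : ∀ r s : A, r * s = s * r)
    {a : Aᵐᵒᵖ →ₐ[k] Module.End k (G → A)} (ha : ∀ r f g, a (op r) f g = f g * r)
    (x y : (G → A) ⊗[k] (G → A)) :
    evalCoord G a (x * y) = evalCoord G a x * evalCoord G a y :=
  evalCoord_mul (fun r m n => funext fun g => by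
      rw [ha, Pi.mul_apply, Pi.mul_apply, ha, mul_assoc, hA (n g), ← mul_assoc])
    (fun r m n => funext fun g => by
      rw [ha, Pi.mul_apply, Pi.mul_apply, ha, mul_assoc]) x y

/-- The common shape of the counit and antipode axioms: each leg is composed with a self-map of `G`
(constant `1`, identity or inversion), so the product samples the two-variable function at one
point. The variant with `TensorProduct.comm` differs by the order of the factors in `A`. -/
theorem mul'_map_apply {a : Aᵐᵒᵖ →ₐ[k] Module.End k (G → A)}
    (ha : ∀ r f g, a (op r) f g = f g * r) (α β : (G → A) →ₗ[k] (G → A)) (u v : G → G)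
    (hα : ∀ f g, α f g = f (u g)) (hβ : ∀ f g, β f g = f (v g)) (x : (G → A) ⊗[k] (G → A)) (g : G) :
    LinearMap.mul' k (G → A) (TensorProduct.map α β x) g = evalCoord G a x (v g) (u g) := by
  induction x using TensorProduct.induction_on with
  | zero => simp
  | add x y hx hy => simp only [map_add, Pi.add_apply, hx, hy]
  | tmul p q => simp [hα, hβ, ha]

theorem mul'_comm_map_apply (hA : ∀ r s : A, r * s = s * r)
    {a : Aᵐᵒᵖ →ₐ[k] Module.End k (G → A)}
    (ha : ∀ r f g, a (op r) f g = f g * r) (α β : (G → A) →ₗ[k] (G → A)) (u v : G → G)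
    (hα : ∀ f g, α f g = f (u g)) (hβ : ∀ f g, β f g = f (v g)) (x : (G → A) ⊗[k] (G → A)) (g : G) :
    LinearMap.mul' k (G → A) (TensorProduct.comm k (G → A) (G → A) (TensorProduct.map α β x)) g =
      evalCoord G a x (v g) (u g) := by
  induction x using TensorProduct.induction_on with
  | zero => simp
  | add x y hx hy => simp only [map_add, Pi.add_apply, hx, hy]
  | tmul p q => simp [hα, hβ, ha, hA]

theorem mul'_map_proj {a : Aᵐᵒᵖ →ₐ[k] Module.End k (G → A)}
    (ha : ∀ r f g, a (op r) f g = f g * r) (x : (G → A) ⊗[k] (G → A)) (g h : G) :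
    LinearMap.mul' k A (TensorProduct.map (LinearMap.proj g) (LinearMap.proj h) x) =
      evalCoord G a x h g := by
  induction x using TensorProduct.induction_on with
  | zero => simp
  | add x y hx hy => simp only [map_add, Pi.add_apply, hx, hy]
  | tmul p q => simp [ha]

variable [Fintype G] [DecidableEq G] [Group G]

/-- The left bialgebroid `C(G, A)`. -/
noncomputable def functionLeftBialgebroid (k : Type u) [CommRing k] [Algebra k A] (G : Type x)
    [Fintype G] [DecidableEq G] [Group G] (hA : ∀ r s : A, r * s = s * r) :
    LeftBialgebroid k A (G → A) where
  s := Pi.constAlgHom k G A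
  t := constOp k G hA
  -- The index of `balEquiv` is the argument of the second leg, so translating by it encodes `(g',
  -- g) ↦ f (g' * g)`. The coproduct is thus itself a coaction, and coassociativity is a case of
  -- `coact_coassoc`.
  Δ := coact (rightTranslation k G A) _ _ lmulAct_const
  ε := LinearMap.proj 1
  source_target_comm l l' := funext fun _ => hA _ _
  Δ_bimodule l l' h x hx := by
    rw [bmk_eq_coact_iff] at hx
    rw [coact_eq_bmk_iff]
    intro g
    rw [evalCoord_mul_of_pointwise hA (lmulAct_constOp hA), Pi.mul_apply, hx]
    ext g'
    simp only [evalCoord_tmul, Pi.mul_apply, rightTranslation_apply, lmulAct_constOp]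
    rfl
  ε_bimodule l l' h := by
    change l * l' * h 1 = l * h 1 * l'
    rw [mul_assoc, hA l', mul_assoc]
  coassoc h x hx := coact_coassoc (fun _ _ => rfl) _ (lmulAct_constOp hA) _
    (fun g r m => funext fun g' => by
      simp only [rightTranslation_apply, lmulAct_constOp]) h x x hx hx
  counit_left h x hx := by
    rw [bmk_eq_coact_iff] at hx
    ext g
    rw [mul'_map_apply (lmulAct_constOp hA) _ _ (fun _ => 1) id (fun _ _ => rfl) (fun _ _ => rfl),
      hx]
    simp
  counit_right h x hx := by
    rw [bmk_eq_coact_iff] at hx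
    ext g
    rw [mul'_comm_map_apply hA (lmulAct_constOp hA) _ _ id (fun _ => 1) (fun _ _ => rfl)
      (fun _ _ => rfl), hx]
    simp
  takeuchi l h x _ := by
    rw [bmk_eq_iff lmulAct_const, evalCoord_mul_of_pointwise hA (lmulAct_constOp hA),
      evalCoord_mul_of_pointwise hA (lmulAct_constOp hA)]
    congr 1
    ext g g'
    simp only [evalCoord_tmul, lmulAct_constOp]
    simp
  Δ_one := by
    rw [coact_eq_bmk_iff]
    intro g
    ext g'
    simp only [evalCoord_tmul, lmulAct_constOp]
    simp
  Δ_mul h h' x x' hx hx' := by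
    rw [bmk_eq_coact_iff] at hx hx'
    rw [coact_eq_bmk_iff]
    intro g
    rw [evalCoord_mul_of_pointwise hA (lmulAct_constOp hA), Pi.mul_apply, hx, hx']
    rfl
  ε_extends _ _ := rfl
  ε_one_action l := one_mul l
  ε_mul_action h h' l := mul_assoc _ _ _

/-- The right bialgebroid `C(G, A)`. -/
noncomputable def functionRightBialgebroid (k : Type u) [CommRing k] [Algebra k A] (G : Type x)
    [Fintype G] [DecidableEq G] [Group G] (hA : ∀ r s : A, r * s = s * r) :
    RightBialgebroid k A (G → A) where
  s := Pi.constAlgHom k G A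
  t := constOp k G hA
  Δ := coact (rightTranslation k G A) _ _ (rmulActOp_constOp hA)
  ε := LinearMap.proj 1
  source_target_comm l l' := funext fun _ => hA _ _
  Δ_bimodule l l' h x hx := by
    rw [bmk_eq_coact_iff] at hx
    rw [coact_eq_bmk_iff]
    intro g
    rw [evalCoord_mul_of_pointwise hA rmulAct_const, Pi.mul_apply, hx]
    ext g'
    simp only [evalCoord_tmul, Pi.mul_apply, rightTranslation_apply, rmulAct_const]
    change h (g' * g) * l' * l = h (g' * g) * (l * l')
    rw [mul_assoc, hA l]
  ε_bimodule l l' h := by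
    change h 1 * l' * l = l * h 1 * l'
    rw [hA _ l, mul_assoc]
  coassoc h x hx := coact_coassoc (fun _ _ => rfl) _ rmulAct_const _
    (fun g r m => funext fun g' => by
      simp only [rightTranslation_apply, rmulAct_const]) h x x hx hx
  counit_left h x hx := by
    rw [bmk_eq_coact_iff] at hx
    ext g
    rw [mul'_comm_map_apply hA rmulAct_const _ _ (fun _ => 1) id (fun _ _ => rfl)
      (fun _ _ => rfl), hx]
    simp
  counit_right h x hx := by
    rw [bmk_eq_coact_iff] at hx
    ext g
    rw [mul'_map_apply rmulAct_const _ _ id (fun _ => 1) (fun _ _ => rfl)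
      (fun _ _ => rfl), hx]
    simp
  takeuchi l h x _ := by
    rw [bmk_eq_iff (rmulActOp_constOp hA), evalCoord_mul_of_pointwise hA rmulAct_const,
      evalCoord_mul_of_pointwise hA rmulAct_const]
    congr 1
    ext g g'
    simp only [evalCoord_tmul, rmulAct_const]
    simp
  Δ_one := by
    rw [coact_eq_bmk_iff]
    intro g
    ext g'
    simp only [evalCoord_tmul, rmulAct_const]
    simp
  Δ_mul h h' x x' hx hx' := by
    rw [bmk_eq_coact_iff] at hx hx'
    rw [coact_eq_bmk_iff]
    intro g
    rw [evalCoord_mul_of_pointwise hA rmulAct_const, Pi.mul_apply, hx, hx']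
    rfl
  ε_extends _ _ := rfl
  ε_one_action l := mul_one l
  ε_mul_action h h' l := (mul_assoc _ _ _).symm

/-- The Hopf algebroid `C(G, A)` of functions on a finite group with values in a commutative
algebra. -/
noncomputable def functionHopfAlgebroid (k : Type u) [CommRing k] [Algebra k A] (G : Type x)
    [Fintype G] [DecidableEq G] [Group G] (hA : ∀ r s : A, r * s = s * r) :
    HopfAlgebroid k A A (G → A) where
  left := functionLeftBialgebroid k G hA
  right := functionRightBialgebroid k G hA
  S := LinearEquiv.funCongrLeft k A (Equiv.inv G)
  sL_εL_tR _ := rfl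
  tR_εR_sL _ := rfl
  tL_εL_sR _ := rfl
  sR_εR_tL _ := rfl
  -- Both coproducts encode the same function on `G × G`, so the mixed laws are again associativity
  -- in `G`; commutativity of `A` identifies the left and right actions.
  Δ_comm_LR h x y hx hy := coact_coassoc (fun r f => funext fun g => hA r.unop (f g)) _
    rmulAct_const _
    (fun g r m => funext fun g' => by
      simp only [functionLeftBialgebroid, rightTranslation_apply, lmulAct_constOp]) h x y hx hy
  Δ_comm_RL h x y hx hy := coact_coassoc (fun r f => funext fun g => hA (f g) r.unop) _
    (lmulAct_constOp hA) _
    (fun g r m => funext fun g' => by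
      simp only [functionRightBialgebroid, rightTranslation_apply, rmulAct_const]) h y x hy hx
  S_bimodule l r h := funext fun g => by
    change l * h g⁻¹ * r = r * h g⁻¹ * l
    rw [hA _ r, hA l, mul_assoc]
  antipode_left h x hx := by
    replace hx := (bmk_eq_coact_iff _ _ _).1 hx
    ext g
    -- The product samples the coproduct at `(g⁻¹, g)`, where its value is `h (g⁻¹ * g) = h 1`.
    erw [mul'_map_apply (lmulAct_constOp hA) _ _ (fun g => g⁻¹) id (fun _ _ => rfl)
      (fun _ _ => rfl), hx]
    simp [functionRightBialgebroid]
  antipode_right h x hx := by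
    replace hx := (bmk_eq_coact_iff _ _ _).1 hx
    ext g
    erw [mul'_map_apply rmulAct_const _ _ id (fun g => g⁻¹) (fun _ _ => rfl)
      (fun _ _ => rfl), hx]
    simp [functionLeftBialgebroid]

theorem functionHopfAlgebroid_isCommutative (hA : ∀ r s : A, r * s = s * r) :
    (functionHopfAlgebroid k G hA).IsCommutative :=
  ⟨fun _ _ => funext fun _ => hA _ _, hA, hA⟩

theorem functionHopfAlgebroid_isFunctionAlgebra (hA : ∀ r s : A, r * s = s * r) :
    (functionHopfAlgebroid k G hA).IsFunctionAlgebra where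
  left_source _ _ := rfl
  left_target _ _ := rfl
  right_source _ _ := rfl
  right_target _ _ := rfl
  left_counit _ := rfl
  right_counit _ := rfl
  antipode _ _ := rfl
  left_comul f x hx g h := by
    replace hx := (bmk_eq_coact_iff _ _ _).1 hx
    rw [mul'_map_proj (lmulAct_constOp hA)]
    exact congrFun (hx h) g
  right_comul f x hx g h := by
    replace hx := (bmk_eq_coact_iff _ _ _).1 hx
    rw [mul'_map_proj rmulAct_const]
    exact congrFun (hx h) g

end FunctionHopfAlgebroid

/-! ### Finitely generated projective modules -/

section Projective

variable {k : Type u} [CommRing k] {R : Type v} [Ring R] [Algebra k R]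

/-- The dual basis criterion. -/
theorem isFGProjective_of_dual_basis {M : Type w} [AddCommGroup M] [Module k M]
    {φ : R →ₐ[k] Module.End k M} {ι : Type*} [Fintype ι] (y : ι → M) (f : ι → M →+ R)
    (hf : ∀ i r m, f i (φ r m) = r * f i m) (hy : ∀ m, ∑ i, φ (f i m) (y i) = m) :
    IsFGProjective φ := by
  let _ : Module R M := Module.compHom M φ.toRingHom
  have hsmul : ∀ (r : R) (m : M), r • m = φ r m := fun _ _ => rfl
  let i : M →ₗ[R] (ι → R) := LinearMap.pi fun i =>
    { f i with map_smul' := fun r m => hf i r m }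
  let s : (ι → R) →ₗ[R] M := Fintype.linearCombination R y
  have hs : s ∘ₗ i = LinearMap.id := by
    ext m
    simpa [s, i, Fintype.linearCombination_apply, hsmul] using hy m
  exact ⟨Module.Finite.of_surjective s fun m => ⟨i m, LinearMap.congr_fun hs m⟩,
    Module.Projective.of_split i s hs⟩

variable {A : Type v} [Ring A] [Algebra k A] {G : Type x} [Fintype G] [DecidableEq G] [Group G]

/-- The indicator functions and the evaluations at points form dual bases; for the actions of `Aᵐᵒᵖ`
the evaluations are read in `Aᵐᵒᵖ`. -/
theorem functionHopfAlgebroid_isFGProjective (hA : ∀ r s : A, r * s = s * r) :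
    (functionHopfAlgebroid k G hA).IsFGProjective := by
  have h1 : ∀ φ : A →ₐ[k] Module.End k (G → A), (∀ r f g, φ r f g = r * f g) →
      IsFGProjective φ := fun φ hφ =>
    isFGProjective_of_dual_basis (fun g => Pi.single g 1) (fun g => Pi.evalAddMonoidHom _ g)
      (fun g r f => hφ r f g) (sum_const_mul_single hφ)
  have h2 : ∀ φ : Aᵐᵒᵖ →ₐ[k] Module.End k (G → A), (∀ r f g, φ (op r) f g = f g * r) →
      IsFGProjective φ := fun φ hφ =>
    isFGProjective_of_dual_basis (fun g => Pi.single g 1)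
      (fun g => (opAddEquiv : A ≃+ Aᵐᵒᵖ).toAddMonoidHom.comp (Pi.evalAddMonoidHom _ g))
      (fun g r f => by
        have := hφ r.unop f g
        rw [op_unop] at this
        change op (φ r f g) = r * op (f g)
        rw [this]; rfl)
      (fun f => by
        ext h
        simp [Finset.sum_apply, hφ, Pi.single_apply])
  exact ⟨h1 _ lmulAct_const, h2 _ (lmulAct_constOp hA), h2 _ rmulAct_const,
    h1 _ (rmulActOp_constOp hA)⟩

end Projective

/-! ### Galois extensions from finite group actions -/

section GroupAction

variable {k : Type u} [CommRing k] {G : Type w}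
variable {B : Type x} [Ring B] [Algebra k B]

theorem mul_comm_of_le_center {A : Subalgebra k B} (hA : A ≤ Subalgebra.center k B) (r s : A) :
    r * s = s * r :=
  Subtype.ext (Subalgebra.mem_center_iff.1 (hA r.2) s).symm

theorem coe_comm_of_le_center {A : Subalgebra k B} (hA : A ≤ Subalgebra.center k B) (r : A)
    (b : B) : (r : B) * b = b * r :=
  (Subalgebra.mem_center_iff.1 (hA r.2) b).symm

theorem rmulAct_val (A : Subalgebra k B) (r : A) (b : B) : rmulAct A.val (op r) b = b * r := rfl

theorem lmulAct_val (A : Subalgebra k B) (r : A) (b : B) : lmulAct A.val r b = r * b := rfl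

theorem evalCoord_mul_of_le_center {A : Subalgebra k B} (hA : A ≤ Subalgebra.center k B)
    (x y : B ⊗[k] (G → A)) :
    evalCoord G (rmulAct A.val) (x * y) =
      evalCoord G (rmulAct A.val) x * evalCoord G (rmulAct A.val) y :=
  evalCoord_mul (fun r m n => by
      rw [rmulAct_val, rmulAct_val, mul_assoc, mul_assoc, coe_comm_of_le_center hA])
    (fun r m n => mul_assoc _ _ _) x y

/-- This carries the linearity axioms of a comodule to `C(G, B)`: a constant on the function leg can
be moved to the leg `B`. -/
theorem evalCoord_lTensor {A : Subalgebra k B} (hA : A ≤ Subalgebra.center k B)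
    (r : A) (φ : (G → A) →ₗ[k] (G → A)) (hφ : ∀ f g, φ f g = r * f g)
    (x : B ⊗[k] (G → A)) (g : G) :
    evalCoord G (rmulAct A.val) (φ.lTensor B x) g = evalCoord G (rmulAct A.val) x g * r := by
  induction x using TensorProduct.induction_on with
  | zero => simp
  | add x y hx hy => simp only [map_add, Pi.add_apply, hx, hy, add_mul]
  | tmul b f =>
    rw [LinearMap.lTensor_tmul, evalCoord_tmul, evalCoord_tmul, hφ, rmulAct_val, rmulAct_val,
      mul_comm_of_le_center hA, Subalgebra.coe_mul, mul_assoc]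

variable [Group G]

/-- The underlying linear representation of an action by algebra automorphisms. -/
def linearRep (σ : G →* (B ≃ₐ[k] B)) : G →* Module.End k B where
  toFun g := (σ g).toLinearMap
  map_one' := by ext; simp
  map_mul' g h := by ext; simp

@[simp] theorem linearRep_apply (σ : G →* (B ≃ₐ[k] B)) (g : G) (b : B) :
    linearRep σ g b = σ g b := rfl

/-- It turns the counit axioms of the coaction into `σ 1 = id`. -/
theorem lift_rmulAct_lTensor (A : Subalgebra k B) (φ : (G → A) →ₗ[k] Aᵐᵒᵖ)
    (hφ : ∀ f, φ f = op (f 1)) (x : B ⊗[k] (G → A)) :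
    TensorProduct.lift (rmulAct A.val).toLinearMap.flip (φ.lTensor B x) =
      evalCoord G (rmulAct A.val) x 1 := by
  induction x using TensorProduct.induction_on with
  | zero => simp
  | add x y hx hy => simp only [map_add, Pi.add_apply, hx, hy]
  | tmul b f =>
    rw [LinearMap.lTensor_tmul, evalCoord_tmul, hφ]
    rfl

variable [Fintype G] [DecidableEq G]

/-- An action of a finite group by automorphisms which fix a central subalgebra `A` makes an algebra
a comodule algebra over `C(G, A)`. -/
noncomputable def functionCoaction (A : Subalgebra k B) (hA : A ≤ Subalgebra.center k B)
    (σ : G →* (B ≃ₐ[k] B)) (hσ : ∀ g, ∀ r : A, σ g r = r) :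
    ComoduleAlgebra (functionHopfAlgebroid k G (mul_comm_of_le_center hA)) B where
  actL := rmulAct A.val
  actR := rmulAct A.val
  -- Both coactions are `b ↦ (g ↦ σ g b)` in `C(G, B)`, so the four coassociativity laws all reduce
  -- to the homomorphism property of `σ`.
  ρL := coact (linearRep σ) _ _ lmulAct_const
  ρR := coact (linearRep σ) _ _ (rmulActOp_constOp (mul_comm_of_le_center hA))
  ρL_L l m x hx := by
    replace hx := (bmk_eq_coact_iff _ _ _).1 hx
    refine (coact_eq_bmk_iff _ _ _).2 fun g => ?_
    rw [evalCoord_lTensor hA l _ fun _ _ => rfl, hx, rmulAct_val]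
    simp [hσ]
  ρL_R l m x hx := by
    replace hx := (bmk_eq_coact_iff _ _ _).1 hx
    refine (coact_eq_bmk_iff _ _ _).2 fun g => ?_
    rw [evalCoord_lTensor hA l _ fun _ _ => mul_comm_of_le_center hA _ _, hx, rmulAct_val]
    simp [hσ]
  ρR_L l m x hx := by
    replace hx := (bmk_eq_coact_iff _ _ _).1 hx
    refine (coact_eq_bmk_iff _ _ _).2 fun g => ?_
    rw [evalCoord_lTensor hA l _ fun _ _ => rfl, hx, rmulAct_val]
    simp [hσ]
  ρR_R l m x hx := by
    replace hx := (bmk_eq_coact_iff _ _ _).1 hx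
    refine (coact_eq_bmk_iff _ _ _).2 fun g => ?_
    rw [evalCoord_lTensor hA l _ fun _ _ => mul_comm_of_le_center hA _ _, hx, rmulAct_val]
    simp [hσ]
  counit_L m x hx := by
    replace hx := (bmk_eq_coact_iff _ _ _).1 hx
    rw [lift_rmulAct_lTensor A _ fun _ => rfl, hx]
    simp
  counit_R m x hx := by
    replace hx := (bmk_eq_coact_iff _ _ _).1 hx
    rw [lift_rmulAct_lTensor A _ fun _ => rfl, hx]
    simp
  coassoc_L m x hx := coact_coassoc (fun _ _ => rfl) _
    (lmulAct_constOp (mul_comm_of_le_center hA)) _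
    (fun g r m => by simp [hσ]) m x x hx hx
  coassoc_R m x hx := coact_coassoc (fun _ _ => rfl) _ rmulAct_const _
    (fun g r m => by simp [hσ]) m x x hx hx
  mixed_RL m x y hx hy := coact_coassoc (fun _ _ => rfl) _
    (lmulAct_constOp (mul_comm_of_le_center hA)) _
    (fun g r m => by simp [hσ]) m x y hx hy
  mixed_LR m x y hx hy := coact_coassoc (fun _ _ => rfl) _ rmulAct_const _
    (fun g r m => by simp [hσ]) m y x hy hx
  η := A.val
  actR_eq := rfl
  ρL_one := (coact_eq_bmk_iff _ _ _).2 fun g => by simp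
  ρR_one := (coact_eq_bmk_iff _ _ _).2 fun g => by simp
  ρL_mul m n x y hx hy := by
    replace hx := (bmk_eq_coact_iff _ _ _).1 hx
    replace hy := (bmk_eq_coact_iff _ _ _).1 hy
    refine (coact_eq_bmk_iff _ _ _).2 fun g => ?_
    rw [evalCoord_mul_of_le_center hA, Pi.mul_apply, hx, hy]
    simp
  ρR_mul m n x y hx hy := by
    replace hx := (bmk_eq_coact_iff _ _ _).1 hx
    replace hy := (bmk_eq_coact_iff _ _ _).1 hy
    refine (coact_eq_bmk_iff _ _ _).2 fun g => ?_
    rw [evalCoord_mul_of_le_center hA, Pi.mul_apply, hx, hy]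
    simp

end GroupAction

/-! ### Galois coordinates, bijectivity of the Galois maps and projectivity -/

section GaloisCoordinates

variable {k : Type u} [CommRing k] {G : Type w} [Group G]
variable {B : Type x} [Ring B] [Algebra k B]
variable {A : Subalgebra k B} {σ : G →* (B ≃ₐ[k] B)}

/-- The Galois map `B ⊗_A B → C(G, B)`, `a ⊗ b ↦ (g ↦ a σ_g(b))`. -/
noncomputable def galoisMapRight (hσ : ∀ b, b ∈ A ↔ ∀ g, σ g b = b) :
    BalTensor (rmulAct A.val) (lmulAct A.val) →ₗ[k] (G → B) :=
  (balRel _ _).liftQ (LinearMap.pi fun g => LinearMap.mul' k B ∘ₗ (σ g).toLinearMap.lTensor B) (by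
    refine Submodule.span_le.2 ?_
    rintro _ ⟨r, a, b, rfl⟩
    rw [SetLike.mem_coe, LinearMap.mem_ker, map_sub, sub_eq_zero]
    ext g
    simp [(hσ r).1 r.2, mul_assoc])

theorem galoisMapRight_apply (hσ : ∀ b, b ∈ A ↔ ∀ g, σ g b = b) (a b : B) (g : G) :
    galoisMapRight hσ (bmk _ _ (a ⊗ₜ b)) g = a * σ g b := rfl

/-- The Galois map `B ⊗_A B → C(G, B)`, `a ⊗ b ↦ (g ↦ σ_g(a) b)`. -/
noncomputable def galoisMapLeft (hσ : ∀ b, b ∈ A ↔ ∀ g, σ g b = b) :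
    BalTensor (rmulAct A.val) (lmulAct A.val) →ₗ[k] (G → B) :=
  (balRel _ _).liftQ (LinearMap.pi fun g => LinearMap.mul' k B ∘ₗ (σ g).toLinearMap.rTensor B) (by
    refine Submodule.span_le.2 ?_
    rintro _ ⟨r, a, b, rfl⟩
    rw [SetLike.mem_coe, LinearMap.mem_ker, map_sub, sub_eq_zero]
    ext g
    simp [(hσ r).1 r.2, mul_assoc])

theorem galoisMapLeft_apply (hσ : ∀ b, b ∈ A ↔ ∀ g, σ g b = b) (a b : B) (g : G) :
    galoisMapLeft hσ (bmk _ _ (a ⊗ₜ b)) g = σ g a * b := rfl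

theorem bmk_mul_tmul (A : Subalgebra k B) (r : A) (a b : B) :
    bmk (rmulAct A.val) (lmulAct A.val) ((a * r) ⊗ₜ b) =
      bmk (rmulAct A.val) (lmulAct A.val) (a ⊗ₜ (r * b)) :=
  (Submodule.Quotient.eq _).2 (Submodule.subset_span ⟨r, a, b, rfl⟩)

variable {ι : Type*} [Fintype ι] {x y : ι → B}

/-- Galois coordinates for an action of a finite group on an algebra. -/
structure IsGaloisCoordinates [DecidableEq G] (σ : G →* (B ≃ₐ[k] B)) (x y : ι → B) : Prop where
  sum_mul : ∀ g, ∑ i, x i * σ g (y i) = if g = 1 then 1 else 0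

/-- Apply `σ g` to the defining relation at `g⁻¹ * g'`. -/
theorem IsGaloisCoordinates.sum_apply_mul_apply [DecidableEq G] (h : IsGaloisCoordinates σ x y)
    (g g' : G) :
    ∑ i, σ g (x i) * σ g' (y i) = if g = g' then 1 else 0 := by
  have := congrArg (σ g) (h.sum_mul (g⁻¹ * g'))
  simp_rw [map_sum, map_mul, ← AlgEquiv.mul_apply, ← map_mul, mul_inv_cancel_left] at this
  simp_rw [inv_mul_eq_one] at this
  rw [this]
  split_ifs <;> simp

variable [Fintype G]

/-- The inverse of `galoisMapRight`. -/
noncomputable def galoisInvRight (A : Subalgebra k B) (σ : G →* (B ≃ₐ[k] B)) (x y : ι → B) :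
    (G → B) →ₗ[k] BalTensor (rmulAct A.val) (lmulAct A.val) :=
  bmk _ _ ∘ₗ ∑ g, ∑ i, (TensorProduct.mk k B B).flip (y i) ∘ₗ
    LinearMap.mulRight k (σ g (x i)) ∘ₗ LinearMap.proj g

theorem galoisInvRight_apply (F : G → B) : galoisInvRight A σ x y F =
    ∑ i, ∑ g, bmk _ _ ((F g * σ g (x i)) ⊗ₜ y i) := by
  rw [Finset.sum_comm]
  simp only [galoisInvRight, LinearMap.comp_apply, LinearMap.sum_apply, map_sum]
  rfl

/-- The inverse of `galoisMapLeft`. -/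
noncomputable def galoisInvLeft (A : Subalgebra k B) (σ : G →* (B ≃ₐ[k] B)) (x y : ι → B) :
    (G → B) →ₗ[k] BalTensor (rmulAct A.val) (lmulAct A.val) :=
  bmk _ _ ∘ₗ ∑ g, ∑ i, TensorProduct.mk k B B (x i) ∘ₗ
      LinearMap.mulLeft k (σ g (y i)) ∘ₗ LinearMap.proj g

theorem galoisInvLeft_apply (F : G → B) : galoisInvLeft A σ x y F =
    ∑ i, ∑ g, bmk _ _ (x i ⊗ₜ (σ g (y i) * F g)) := by
  rw [Finset.sum_comm]
  simp only [galoisInvLeft, LinearMap.comp_apply, LinearMap.sum_apply, map_sum]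
  rfl

/-- The trace of a finite group action, with values in the fixed algebra. -/
def fixedTrace (hσ : ∀ b, b ∈ A ↔ ∀ g, σ g b = b) :
    B →+ A where
  toFun b := ⟨∑ g, σ g b, (hσ _).2 fun h => by
    simp_rw [map_sum, ← AlgEquiv.mul_apply, ← map_mul]
    exact Fintype.sum_equiv (Equiv.mulLeft h) _ _ fun _ => rfl⟩
  map_zero' := Subtype.ext (by simp)
  map_add' b c := Subtype.ext (by simp [Finset.sum_add_distrib])

theorem coe_fixedTrace (hσ : ∀ b, b ∈ A ↔ ∀ g, σ g b = b) (b : B) :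
    (fixedTrace hσ b : B) = ∑ g, σ g b := rfl

theorem fixedTrace_mul (hσ : ∀ b, b ∈ A ↔ ∀ g, σ g b = b) (r : A) (b : B) :
    fixedTrace hσ (r * b) = r * fixedTrace hσ b := by
  refine Subtype.ext ?_
  simp [coe_fixedTrace, Finset.mul_sum, fun g => (hσ r).1 r.2 g]

namespace IsGaloisCoordinates

variable [DecidableEq G]

/-- In the expanded trace, the relations between Galois coordinates kill every term with `g ≠ 1`. So
the `y i` and the functionals `b ↦ tr (b * x i)` are dual bases of `B` over `A`; the same expansion
makes the Galois map injective. -/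
theorem sum_trace_mul (h : IsGaloisCoordinates σ x y) (hσ : ∀ b, b ∈ A ↔ ∀ g, σ g b = b) (b : B) :
    ∑ i, (fixedTrace hσ (b * x i) : B) * y i = b := by
  simp only [coe_fixedTrace, Finset.sum_mul]
  rw [Finset.sum_comm]
  have : ∀ g, ∑ i, σ g (b * x i) * y i = if g = 1 then b else 0 := by
    intro g
    have := h.sum_apply_mul_apply g 1
    simp only [map_one, AlgEquiv.one_apply] at this
    simp_rw [map_mul, mul_assoc, ← Finset.mul_sum, this]
    split_ifs with hg
    · simp [hg]
    · simp
  simp only [this, Finset.sum_ite_eq', Finset.mem_univ, if_true]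

theorem sum_mul_trace (h : IsGaloisCoordinates σ x y) (hσ : ∀ b, b ∈ A ↔ ∀ g, σ g b = b) (b : B) :
    ∑ i, x i * (fixedTrace hσ (y i * b) : B) = b := by
  simp only [coe_fixedTrace, Finset.mul_sum]
  rw [Finset.sum_comm]
  have : ∀ g, ∑ i, x i * σ g (y i * b) = if g = 1 then b else 0 := by
    intro g
    simp_rw [map_mul, ← mul_assoc, ← Finset.sum_mul, h.sum_mul]
    split_ifs with hg
    · simp [hg]
    · simp
  simp only [this, Finset.sum_ite_eq', Finset.mem_univ, if_true]

/-- The Galois map `a ⊗ b ↦ (g ↦ a σ_g(b))` is bijective. -/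
noncomputable def galoisEquivRight (h : IsGaloisCoordinates σ x y)
    (hσ : ∀ b, b ∈ A ↔ ∀ g, σ g b = b) :
    BalTensor (rmulAct A.val) (lmulAct A.val) ≃ₗ[k] (G → B) :=
  LinearEquiv.ofLinearMap (galoisMapRight hσ) (galoisInvRight A σ x y)
    (by
      refine LinearMap.ext fun F => funext fun g' => ?_
      rw [LinearMap.comp_apply, galoisInvRight_apply, Finset.sum_comm]
      simp only [map_sum, Finset.sum_apply, galoisMapRight_apply, mul_assoc, ← Finset.mul_sum,
        h.sum_apply_mul_apply]
      simp)
    (by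
      -- The sum over `g` of `σ g b * σ g (x i)` is a trace, hence lies in `A` and can cross the
      -- balanced tensor sign, where the dual basis expansion restores `b`.
      refine Submodule.linearMap_qext _ (TensorProduct.ext' fun a b => ?_)
      change galoisInvRight A σ x y (galoisMapRight hσ (bmk _ _ (a ⊗ₜ b))) = bmk _ _ (a ⊗ₜ b)
      rw [galoisInvRight_apply]
      simp only [galoisMapRight_apply, mul_assoc, ← map_mul, ← map_sum, ← TensorProduct.sum_tmul,
        ← Finset.mul_sum, ← coe_fixedTrace hσ]
      simp only [map_sum, bmk_mul_tmul]
      rw [← map_sum, ← TensorProduct.tmul_sum, h.sum_trace_mul hσ])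

/-- The Galois map `a ⊗ b ↦ (g ↦ σ_g(a) b)` is bijective. -/
noncomputable def galoisEquivLeft (h : IsGaloisCoordinates σ x y)
    (hσ : ∀ b, b ∈ A ↔ ∀ g, σ g b = b) :
    BalTensor (rmulAct A.val) (lmulAct A.val) ≃ₗ[k] (G → B) :=
  LinearEquiv.ofLinearMap (galoisMapLeft hσ) (galoisInvLeft A σ x y)
    (by
      refine LinearMap.ext fun F => funext fun g' => ?_
      rw [LinearMap.comp_apply, galoisInvLeft_apply, Finset.sum_comm]
      simp only [map_sum, Finset.sum_apply, galoisMapLeft_apply, ← mul_assoc, ← Finset.sum_mul,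
        h.sum_apply_mul_apply]
      simp)
    (by
      refine Submodule.linearMap_qext _ (TensorProduct.ext' fun a b => ?_)
      change galoisInvLeft A σ x y (galoisMapLeft hσ (bmk _ _ (a ⊗ₜ b))) = bmk _ _ (a ⊗ₜ b)
      rw [galoisInvLeft_apply]
      simp only [galoisMapLeft_apply, ← mul_assoc, ← map_mul, ← map_sum, ← TensorProduct.tmul_sum,
        ← Finset.sum_mul, ← coe_fixedTrace hσ]
      simp only [map_sum, ← bmk_mul_tmul]
      rw [← map_sum, ← TensorProduct.sum_tmul, h.sum_mul_trace hσ])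

theorem galoisEquivRight_apply (h : IsGaloisCoordinates σ x y)
    (hσ : ∀ b, b ∈ A ↔ ∀ g, σ g b = b) (a b : B) (g : G) :
    h.galoisEquivRight hσ (bmk _ _ (a ⊗ₜ b)) g = a * σ g b := rfl

theorem galoisEquivLeft_apply (h : IsGaloisCoordinates σ x y)
    (hσ : ∀ b, b ∈ A ↔ ∀ g, σ g b = b) (a b : B) (g : G) :
    h.galoisEquivLeft hσ (bmk _ _ (a ⊗ₜ b)) g = σ g a * b := rfl

/-- Under `B ⊗_A C(G, A) = C(G, B)`, coinvariants are the fixed elements and the two Galois maps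
become `galoisEquivRight` and `galoisEquivLeft`. -/
theorem isGalois (h : IsGaloisCoordinates σ x y) (hA : A ≤ Subalgebra.center k B)
    (hσ : ∀ b, b ∈ A ↔ ∀ g, σ g b = b) :
    (functionCoaction A hA σ fun g r => (hσ r).1 r.2 g).IsGalois A where
  coinvariants_R b := by
    refine (coact_eq_bmk_iff _ _ _).trans ?_
    simp [hσ]
  coinvariants_L b := by
    refine (coact_eq_bmk_iff _ _ _).trans ?_
    simp [hσ]
  gal_R := by
    refine ⟨(h.galoisEquivRight hσ).trans (balEquiv (rmulAct A.val) _
      (rmulActOp_constOp (mul_comm_of_le_center hA))).symm,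
      fun a b x hx => ?_⟩
    replace hx := (bmk_eq_coact_iff _ _ _).1 hx
    refine (symm_eq_bmk_iff (rmulActOp_constOp (mul_comm_of_le_center hA)) _ _).2
      (funext fun g => ?_)
    erw [galoisEquivRight_apply, evalCoord_mul_of_le_center hA, Pi.mul_apply, hx]
    simp
  gal_L := by
    refine ⟨(h.galoisEquivLeft hσ).trans (balEquiv (rmulAct A.val) _ lmulAct_const).symm,
      fun a b x hx => ?_⟩
    replace hx := (bmk_eq_coact_iff _ _ _).1 hx
    refine (symm_eq_bmk_iff lmulAct_const _ _).2 (funext fun g => ?_)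
    erw [galoisEquivLeft_apply, evalCoord_mul_of_le_center hA, Pi.mul_apply, hx]
    simp

/-- An action of a finite group with central fixed algebra and with Galois coordinates is a local
covering. -/
noncomputable def localCovering (h : IsGaloisCoordinates σ x y) (hA : A ≤ Subalgebra.center k B)
    (hσ : ∀ b, b ∈ A ↔ ∀ g, σ g b = b) :
    LocalNCCovering A (functionHopfAlgebroid k G (mul_comm_of_le_center hA)) where
  base_le := le_rfl
  hopf_fgProjective := functionHopfAlgebroid_isFGProjective _
  coaction := functionCoaction A hA σ fun g r => (hσ r).1 r.2 g
  unit_eq := rfl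
  galois := h.isGalois hA hσ
  left_fgProjective := isFGProjective_of_dual_basis y
    (fun i => (fixedTrace hσ).comp (AddMonoidHom.mulRight (x i)))
    (fun i r b => by
      simp only [AddMonoidHom.comp_apply, AddMonoidHom.mulRight_apply, lmulAct_val, mul_assoc,
        fixedTrace_mul])
    (h.sum_trace_mul hσ)
  -- As `A` is central, the left dual basis also serves for the right module.
  right_fgProjective := isFGProjective_of_dual_basis y
    (fun i => (opAddEquiv : A ≃+ Aᵐᵒᵖ).toAddMonoidHom.comp
      ((fixedTrace hσ).comp (AddMonoidHom.mulRight (x i))))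
    (fun i r b => by
      change op (fixedTrace hσ (b * r.unop * x i)) = r * op (fixedTrace hσ (b * x i))
      rw [← coe_comm_of_le_center hA, mul_assoc, fixedTrace_mul, mul_comm_of_le_center hA]
      rfl)
    (fun b => by
      refine Eq.trans (Finset.sum_congr rfl fun i _ => ?_) (h.sum_trace_mul hσ b)
      exact (coe_comm_of_le_center hA _ _).symm)

end IsGaloisCoordinates

end GaloisCoordinates

/-! ### The action of `ℤ/m × ℤ/m` on an algebra generated by a rational rotation pair -/

theorem sum_pow_val {m : ℕ} [NeZero m] {z : ℂ} (hz : z ^ m = 1) :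
    ∑ a : ZMod m, z ^ a.val = if z = 1 then (m : ℂ) else 0 := by
  split_ifs with h
  · simp [h, ZMod.card]
  · obtain ⟨l, rfl⟩ := Nat.exists_eq_succ_of_ne_zero (NeZero.ne m)
    have : ∑ a : ZMod (l + 1), z ^ a.val = ∑ i ∈ Finset.range (l + 1), z ^ i :=
      Fin.sum_univ_eq_sum_range (fun i => z ^ i) (l + 1)
    exact this.trans (by rw [geom_sum_eq h, hz, sub_self, zero_div])

theorem IsPrimitiveRoot.pow_val_eq_one_iff {m : ℕ} [NeZero m] {z : ℂ} (hz : IsPrimitiveRoot z m)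
    (a : ZMod m) : z ^ a.val = 1 ↔ a = 0 := by
  rw [hz.pow_eq_one_iff_dvd, ← ZMod.natCast_eq_zero_iff, ZMod.natCast_zmod_val]

section RotationPair

variable {B : Type*} [Ring B] [Algebra ℂ B]

/-- Conjugation by units. -/
def unitConj : Bˣ →* (B ≃ₐ[ℂ] B) where
  toFun u := AlgEquiv.ofAlgHom
    { toFun := fun b => u * b * ↑u⁻¹
      map_one' := by simp
      map_mul' := fun a b => by simp [mul_assoc]
      map_zero' := by simp
      map_add' := fun a b => by simp [mul_add, add_mul]
      commutes' := fun c => by rw [← Algebra.commutes, mul_assoc]; simp }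
    { toFun := fun b => ↑u⁻¹ * b * u
      map_one' := by simp
      map_mul' := fun a b => by simp [mul_assoc]
      map_zero' := by simp
      map_add' := fun a b => by simp [mul_add, add_mul]
      commutes' := fun c => by rw [← Algebra.commutes, mul_assoc]; simp }
    (by ext; simp [mul_assoc]) (by ext; simp [mul_assoc])
  map_one' := by ext; simp
  map_mul' u v := by ext; simp [mul_assoc]

@[simp] theorem unitConj_apply (u : Bˣ) (b : B) : unitConj u b = u * b * ↑u⁻¹ := rfl

theorem unitConj_eq_self_iff (u : Bˣ) (b : B) : unitConj u b = b ↔ u * b = b * u := by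
  rw [unitConj_apply, Units.mul_inv_eq_iff_eq_mul]

theorem pow_apply_of_apply_eq_smul {φ : B ≃ₐ[ℂ] B} {c : ℂ} {b : B} (h : φ b = c • b) (n : ℕ) :
    (φ ^ n) b = c ^ n • b := by
  induction n with
  | zero => simp
  | succ n ih => rw [pow_succ', AlgEquiv.mul_apply, ih, map_smul, h, smul_smul, pow_succ]

/-- Invertible elements with `u v = z v u`, where `z` is a primitive `m`-th root of unity, such that
the powers `u ^ m`, `v ^ m` are central and the commutant of `u` and `v` is the centre. -/
structure RotationPair (B : Type*) [Ring B] [Algebra ℂ B] (m : ℕ) where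
  /-- the first unit -/
  u : Bˣ
  /-- the second unit -/
  v : Bˣ
  /-- the root of unity -/
  z : ℂ
  primitive : IsPrimitiveRoot z m
  comm : (u * v : B) = z • (v * u : B)
  mem_center : ∀ b : B, u * b = b * u → v * b = b * v → b ∈ Subalgebra.center ℂ B

namespace RotationPair

variable {m : ℕ} (p : RotationPair B m)

theorem conj_u_u : unitConj p.u (p.u : B) = p.u := by simp

theorem conj_v_v : unitConj p.v (p.v : B) = p.v := by simp

theorem conj_u_v : unitConj p.u (p.v : B) = p.z • (p.v : B) := by
  rw [unitConj_apply, Units.mul_inv_eq_iff_eq_mul, p.comm, smul_mul_assoc]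

theorem conj_u_monomial (i j : ℕ) :
    unitConj p.u ((p.u : B) ^ i * (p.v : B) ^ j) = p.z ^ j • ((p.u : B) ^ i * (p.v : B) ^ j) := by
  rw [map_mul, map_pow, map_pow, conj_u_u, conj_u_v, smul_pow, mul_smul_comm]

theorem z_inv_pow : p.z⁻¹ ^ m = 1 := by rw [inv_pow, p.primitive.pow_eq_one, inv_one]

theorem pow_pow_eq_one {c : ℂ} (hc : c ^ m = 1) (i : ℕ) : (c ^ i) ^ m = 1 := by
  rw [← pow_mul, mul_comm, pow_mul, hc, one_pow]

theorem conj_pow_eq_one {u : Bˣ} (hu : (u : B) ^ m ∈ Subalgebra.center ℂ B) :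
    unitConj u ^ m = 1 := by
  rw [← map_pow]
  ext b
  rw [AlgEquiv.one_apply, unitConj_eq_self_iff, Units.val_pow_eq_pow_val]
  exact (Subalgebra.mem_center_iff.1 hu b).symm

/-- Conjugation by `u` multiplies `v ^ m` by `z ^ m = 1`, so it commutes with both generators. -/
theorem v_pow_mem_center : (p.v : B) ^ m ∈ Subalgebra.center ℂ B := by
  refine p.mem_center _ ?_ (by rw [← pow_succ, ← pow_succ'])
  rw [← unitConj_eq_self_iff]
  have := p.conj_u_monomial 0 m
  rwa [pow_zero, one_mul, p.primitive.pow_eq_one, one_smul] at this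

/-- The products `u v` and `v u` differ by a scalar, which conjugation does not see. -/
theorem conj_commute : Commute (unitConj p.u) (unitConj p.v) := by
  ext b
  rw [← map_mul, ← map_mul, unitConj_apply, Units.mul_inv_eq_iff_eq_mul, Units.val_mul, p.comm,
    mul_smul_comm, ← Units.val_mul, smul_mul_assoc, unitConj_apply, Units.inv_mul_cancel_right]

variable [NeZero m]

theorem z_ne_zero : p.z ≠ 0 := p.primitive.ne_zero (NeZero.ne m)

theorem conj_v_u : unitConj p.v (p.u : B) = p.z⁻¹ • (p.u : B) := by
  rw [unitConj_apply, Units.mul_inv_eq_iff_eq_mul, smul_mul_assoc, p.comm, smul_smul,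
    inv_mul_cancel₀ p.z_ne_zero, one_smul]

theorem conj_v_monomial (i j : ℕ) :
    unitConj p.v ((p.u : B) ^ i * (p.v : B) ^ j) =
      p.z⁻¹ ^ i • ((p.u : B) ^ i * (p.v : B) ^ j) := by
  rw [map_mul, map_pow, map_pow, conj_v_v, conj_v_u, smul_pow, smul_mul_assoc]

theorem u_pow_mem_center : (p.u : B) ^ m ∈ Subalgebra.center ℂ B := by
  refine p.mem_center _ (by rw [← pow_succ, ← pow_succ']) ?_
  rw [← unitConj_eq_self_iff]
  have := p.conj_v_monomial m 0
  rwa [pow_zero, mul_one, inv_pow, p.primitive.pow_eq_one, inv_one, one_smul] at this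

/-- The action of `ℤ/m × ℤ/m` by inner automorphisms. -/
def action : Multiplicative (ZMod m × ZMod m) →* (B ≃ₐ[ℂ] B) where
  toFun g := unitConj p.u ^ g.toAdd.1.val * unitConj p.v ^ g.toAdd.2.val
  map_one' := by simp
  map_mul' g h := by
    -- Representatives add only modulo `m`; the reduction is harmless because the `m`-th power of
    -- each conjugation is trivial.
    simp only [toAdd_mul, Prod.fst_add, Prod.snd_add, ZMod.val_add]
    rw [← pow_eq_pow_mod _ (conj_pow_eq_one p.u_pow_mem_center),
      ← pow_eq_pow_mod _ (conj_pow_eq_one p.v_pow_mem_center), pow_add, pow_add, mul_assoc,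
      mul_assoc, ← mul_assoc _ _ (unitConj p.v ^ _), (p.conj_commute.pow_pow _ _).eq, mul_assoc]

theorem action_apply (g : Multiplicative (ZMod m × ZMod m)) :
    p.action g = unitConj p.u ^ g.toAdd.1.val * unitConj p.v ^ g.toAdd.2.val := rfl

theorem action_monomial (g : Multiplicative (ZMod m × ZMod m)) (i j : ℕ) :
    p.action g ((p.u : B) ^ i * (p.v : B) ^ j) =
      ((p.z ^ j) ^ g.toAdd.1.val * (p.z⁻¹ ^ i) ^ g.toAdd.2.val) •
        ((p.u : B) ^ i * (p.v : B) ^ j) := by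
  rw [action_apply, AlgEquiv.mul_apply, pow_apply_of_apply_eq_smul (p.conj_v_monomial i j), map_smul,
    pow_apply_of_apply_eq_smul (p.conj_u_monomial i j), smul_smul, mul_comm]

/-- Inner automorphisms fix the centre; conversely, the generators `(1, 0)` and `(0, 1)` act by
conjugation with `u` and `v`, whose commutant is the centre. -/
theorem mem_center_iff (b : B) : b ∈ Subalgebra.center ℂ B ↔ ∀ g, p.action g b = b := by
  constructor
  · intro hb g
    have h : ∀ c : Bˣ, unitConj c b = (1 : ℂ) • b := fun c => by
      rw [one_smul, unitConj_eq_self_iff]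
      exact Subalgebra.mem_center_iff.1 hb c
    rw [action_apply, AlgEquiv.mul_apply, pow_apply_of_apply_eq_smul (h p.v), map_smul,
      pow_apply_of_apply_eq_smul (h p.u)]
    simp
  · intro h
    have hu := h (Multiplicative.ofAdd (1, 0))
    have hv := h (Multiplicative.ofAdd (0, 1))
    -- The representative of `1` is `1 % m`, which is `0` for `m = 1`; the exponent `1` is recovered
    -- from the triviality of the `m`-th powers.
    simp only [action_apply, toAdd_ofAdd, ZMod.val_one_eq_one_mod, ZMod.val_zero, pow_zero, mul_one,
      one_mul, ← pow_eq_pow_mod _ (conj_pow_eq_one p.u_pow_mem_center),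
      ← pow_eq_pow_mod _ (conj_pow_eq_one p.v_pow_mem_center), pow_one] at hu hv
    exact p.mem_center b ((unitConj_eq_self_iff _ _).1 hu) ((unitConj_eq_self_iff _ _).1 hv)

theorem sum_characters (c d : ℂ) (hc : c ^ m = 1) (hd : d ^ m = 1) :
    ∑ g : ZMod m × ZMod m, c ^ g.1.val * d ^ g.2.val =
      if c = 1 ∧ d = 1 then (m : ℂ) ^ 2 else 0 := by
  rw [Fintype.sum_prod_type]
  simp only [← Finset.mul_sum, ← Finset.sum_mul, sum_pow_val hc, sum_pow_val hd]
  split_ifs <;> simp_all [sq]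

/-- Each monomial is an eigenvector of the action, so its inverse times its image is a scalar, a
root of unity. Summed over all monomials these scalars give `|G| = m ^ 2` at `g = 1` and `0`
elsewhere, which explains the factor `(m ^ 2)⁻¹`. -/
theorem isGaloisCoordinates : IsGaloisCoordinates p.action
    (fun c : ZMod m × ZMod m =>
      ((m : ℂ) ^ 2)⁻¹ • (↑(p.u ^ c.1.val * p.v ^ c.2.val)⁻¹ : B))
    (fun c => (p.u : B) ^ c.1.val * (p.v : B) ^ c.2.val) where
  sum_mul g := by
    have h1 : ∀ c : ZMod m × ZMod m,
        (↑(p.u ^ c.1.val * p.v ^ c.2.val)⁻¹ : B) * ((p.u : B) ^ c.1.val * (p.v : B) ^ c.2.val) =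
          1 := by
      intro c
      rw [← Units.val_pow_eq_pow_val, ← Units.val_pow_eq_pow_val, ← Units.val_mul, Units.inv_mul]
    have hm : ((m : ℂ) ^ 2) ≠ 0 := pow_ne_zero _ (Nat.cast_ne_zero.2 (NeZero.ne m))
    simp only [action_monomial, smul_mul_assoc, mul_smul_comm, h1,
      ← Finset.sum_smul]
    -- The eigenvalue of `g` on the monomial `c` is reread as a character of `c` with parameter `g`,
    -- so that orthogonality applies to the sum over `c`.
    have h2 : ∀ c : ZMod m × ZMod m,
        (p.z ^ c.2.val) ^ g.toAdd.1.val * (p.z⁻¹ ^ c.1.val) ^ g.toAdd.2.val =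
          (p.z⁻¹ ^ g.toAdd.2.val) ^ c.1.val * (p.z ^ g.toAdd.1.val) ^ c.2.val := by
      intro c
      rw [mul_comm, pow_right_comm, pow_right_comm p.z]
    simp only [h2]
    rw [sum_characters _ _ (pow_pow_eq_one p.z_inv_pow _)
      (pow_pow_eq_one p.primitive.pow_eq_one _)]
    simp only [p.primitive.inv.pow_val_eq_one_iff, p.primitive.pow_val_eq_one_iff]
    have hg : (g.toAdd.2 = 0 ∧ g.toAdd.1 = 0) ↔ g = 1 := by
      rw [and_comm, ← toAdd_eq_zero, Prod.ext_iff]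
      rfl
    simp only [hg]
    split_ifs
    · rw [smul_smul, mul_inv_cancel₀ hm, one_smul]
    · simp

/-- The averaged conjugates of a monomial. -/
theorem sum_action_monomial (i j : ℕ) :
    ((m : ℂ) ^ 2)⁻¹ • ∑ g, p.action g ((p.u : B) ^ i * (p.v : B) ^ j) =
      if m ∣ i ∧ m ∣ j then (p.u : B) ^ i * (p.v : B) ^ j else 0 := by
  have hm : ((m : ℂ) ^ 2) ≠ 0 := pow_ne_zero _ (Nat.cast_ne_zero.2 (NeZero.ne m))
  simp only [action_monomial, ← Finset.sum_smul]
  have := sum_characters (p.z ^ j) (p.z⁻¹ ^ i) (pow_pow_eq_one p.primitive.pow_eq_one _)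
    (pow_pow_eq_one p.z_inv_pow _)
  simp only [p.primitive.pow_eq_one_iff_dvd, p.primitive.inv.pow_eq_one_iff_dvd] at this
  rw [show (∑ g : Multiplicative (ZMod m × ZMod m),
    (p.z ^ j) ^ g.toAdd.1.val * (p.z⁻¹ ^ i) ^ g.toAdd.2.val) = _ from
    (Fintype.sum_equiv Multiplicative.toAdd _ _ fun _ => rfl).trans this]
  simp only [and_comm (a := m ∣ i)]
  split_ifs
  · rw [smul_smul, inv_mul_cancel₀ hm, one_smul]
  · simp

end RotationPair

end RotationPair

/-! ### Reduction of words to monomials and averaging over the group -/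

namespace RotationPair

variable {B : Type*} [Ring B] [Algebra ℂ B] {m : ℕ} (p : RotationPair B m)

theorem v_mul_u_pow [NeZero m] (i : ℕ) :
    (p.v : B) * (p.u : B) ^ i = p.z⁻¹ ^ i • ((p.u : B) ^ i * p.v) := by
  have := p.conj_v_monomial i 0
  rwa [pow_zero, mul_one, unitConj_apply, Units.mul_inv_eq_iff_eq_mul, smul_mul_assoc] at this

/-- Every word in `u`, `v` and their inverses is a monomial with coefficient in `C`, for every
central subalgebra `C` which contains `u ^ m`, `v ^ m` and their inverses. -/
theorem exists_monomial_of_mem_closure [NeZero m] {C : Subalgebra ℂ B}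
    (hC : C ≤ Subalgebra.center ℂ B) (hu : (↑(p.u⁻¹ ^ m) : B) ∈ C) (hv : (↑(p.v⁻¹ ^ m) : B) ∈ C)
    {w : B} (hw : w ∈ Submonoid.closure ({↑p.u, ↑p.v, ↑p.u⁻¹, ↑p.v⁻¹} : Set B)) :
    ∃ c ∈ C, ∃ i j : ℕ, w = c * ((p.u : B) ^ i * (p.v : B) ^ j) := by
  have hcomm : ∀ c ∈ C, ∀ b : B, b * c = c * b := fun c hc => Subalgebra.mem_center_iff.1 (hC hc)
  have hmul_u : ∀ y : B, (∃ c ∈ C, ∃ i j : ℕ, y = c * ((p.u : B) ^ i * (p.v : B) ^ j)) →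
      ∃ c ∈ C, ∃ i j : ℕ, p.u * y = c * ((p.u : B) ^ i * (p.v : B) ^ j) := by
    rintro _ ⟨c, hc, i, j, rfl⟩
    exact ⟨c, hc, i + 1, j, by rw [← mul_assoc, hcomm c hc, mul_assoc, ← mul_assoc _ (_ ^ i),
      ← pow_succ']⟩
  have hmul_v : ∀ y : B, (∃ c ∈ C, ∃ i j : ℕ, y = c * ((p.u : B) ^ i * (p.v : B) ^ j)) →
      ∃ c ∈ C, ∃ i j : ℕ, p.v * y = c * ((p.u : B) ^ i * (p.v : B) ^ j) := by
    rintro _ ⟨c, hc, i, j, rfl⟩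
    refine ⟨p.z⁻¹ ^ i • c, C.smul_mem hc _, i, j + 1, ?_⟩
    rw [← mul_assoc, hcomm c hc, mul_assoc, ← mul_assoc _ (_ ^ i), v_mul_u_pow, smul_mul_assoc,
      mul_smul_comm, smul_mul_assoc, mul_assoc (_ ^ i), ← pow_succ']
  have hmul_inv : ∀ x : Bˣ, (↑(x⁻¹ ^ m) : B) ∈ C →
      (∀ y : B, (∃ c ∈ C, ∃ i j : ℕ, y = c * ((p.u : B) ^ i * (p.v : B) ^ j)) →
        ∃ c ∈ C, ∃ i j : ℕ, x * y = c * ((p.u : B) ^ i * (p.v : B) ^ j)) →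
      ∀ y : B, (∃ c ∈ C, ∃ i j : ℕ, y = c * ((p.u : B) ^ i * (p.v : B) ^ j)) →
        ∃ c ∈ C, ∃ i j : ℕ, ↑x⁻¹ * y = c * ((p.u : B) ^ i * (p.v : B) ^ j) := by
    intro x hx hmul y hy
    -- Since `x⁻¹ = x⁻¹ ^ m * x ^ (m - 1)`, multiplication by an inverse is `m - 1` multiplications
    -- by `x` and a factor from `C`; exponents thus stay in `ℕ`.
    have hpow : ∀ l : ℕ, ∃ c ∈ C, ∃ i j : ℕ,
        (x : B) ^ l * y = c * ((p.u : B) ^ i * (p.v : B) ^ j) := by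
      intro l
      induction l with
      | zero => simpa using hy
      | succ l ih =>
        rw [pow_succ', mul_assoc]
        exact hmul _ ih
    obtain ⟨c, hc, i, j, h⟩ := hpow (m - 1)
    refine ⟨↑(x⁻¹ ^ m) * c, C.mul_mem hx hc, i, j, ?_⟩
    have hxm : (↑x⁻¹ : B) = ↑(x⁻¹ ^ m) * (x : B) ^ (m - 1) := by
      have : x⁻¹ = x⁻¹ ^ m * x ^ (m - 1) := by
        rw [inv_pow, eq_inv_mul_iff_mul_eq, mul_inv_eq_iff_eq_mul, pow_sub_one_mul (NeZero.ne m)]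
      rw [← Units.val_pow_eq_pow_val, ← Units.val_mul, ← this]
    rw [hxm, mul_assoc, h, mul_assoc]
  induction hw using Submonoid.closure_induction_left with
  | one => exact ⟨1, C.one_mem, 0, 0, by simp⟩
  | mul_left x hx y _ hy =>
    rcases hx with rfl | rfl | rfl | rfl
    · exact hmul_u y hy
    · exact hmul_v y hy
    · exact hmul_inv p.u hu hmul_u y hy
    · exact hmul_inv p.v hv hmul_v y hy

theorem action_coe_mul [NeZero m] (g : Multiplicative (ZMod m × ZMod m)) {c : B}
    (hc : c ∈ Subalgebra.center ℂ B) (b : B) : p.action g (c * b) = c * p.action g b := by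
  rw [map_mul, (p.mem_center_iff c).1 hc]

/-- The average over the action of `ℤ/m × ℤ/m`. -/
noncomputable def average [NeZero m] : B →ₗ[ℂ] B :=
  ((m : ℂ) ^ 2)⁻¹ • ∑ g, (p.action g).toLinearMap

theorem average_apply [NeZero m] (b : B) :
    p.average b = ((m : ℂ) ^ 2)⁻¹ • ∑ g, p.action g b := by
  simp [average, LinearMap.sum_apply]

theorem average_of_mem_center [NeZero m] {b : B} (hb : b ∈ Subalgebra.center ℂ B) :
    p.average b = b := by
  have hm : ((m : ℂ) ^ 2) ≠ 0 := pow_ne_zero _ (Nat.cast_ne_zero.2 (NeZero.ne m))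
  rw [average_apply, Finset.sum_congr rfl fun g _ => (p.mem_center_iff b).1 hb g,
    Finset.sum_const, Finset.card_univ, Fintype.card_multiplicative, Fintype.card_prod, ZMod.card,
    ← Nat.cast_smul_eq_nsmul ℂ, smul_smul, Nat.cast_mul, ← sq, inv_mul_cancel₀ hm, one_smul]

theorem continuous_average [NeZero m] [TopologicalSpace B] [IsTopologicalRing B]
    [ContinuousConstSMul ℂ B] : Continuous p.average := by
  have hpow : ∀ (c : Bˣ) (l : ℕ), Continuous fun b => (unitConj c ^ l) b := by
    intro c l
    induction l with
    | zero => simpa using! continuous_id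
    | succ l ih =>
      simp only [pow_succ', AlgEquiv.mul_apply, unitConj_apply]
      fun_prop
  simp only [funext p.average_apply, action_apply, AlgEquiv.mul_apply]
  exact (continuous_finsetSum _ fun g _ => (hpow _ _).comp (hpow _ _)).const_smul _

/-- The central coefficient of a word passes through the average, which keeps a monomial only if `m`
divides both exponents, that is, if it is a product of powers of `u ^ m` and `v ^ m`. -/
theorem average_word_mem [NeZero m] {C : Subalgebra ℂ B}
    (hC : C ≤ Subalgebra.center ℂ B) (hu : (p.u : B) ^ m ∈ C) (hv : (p.v : B) ^ m ∈ C)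
    (hu' : (↑(p.u⁻¹ ^ m) : B) ∈ C) (hv' : (↑(p.v⁻¹ ^ m) : B) ∈ C)
    {w : B} (hw : w ∈ Submonoid.closure ({↑p.u, ↑p.v, ↑p.u⁻¹, ↑p.v⁻¹} : Set B)) :
    p.average w ∈ C := by
  obtain ⟨c, hc, i, j, rfl⟩ := p.exists_monomial_of_mem_closure hC hu' hv' hw
  simp only [average_apply, p.action_coe_mul _ (hC hc), ← Finset.mul_sum, ← mul_smul_comm,
    sum_action_monomial]
  refine C.mul_mem hc ?_
  split_ifs with h
  · obtain ⟨⟨i, rfl⟩, ⟨j, rfl⟩⟩ := h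
    rw [pow_mul, pow_mul]
    exact C.mul_mem (C.pow_mem hu _) (C.pow_mem hv _)
  · exact C.zero_mem

end RotationPair

/-- As `T` is closed in `B`, the image of `S` in `B` is closed too and contains the closed star
subalgebra generated by `s`. The relative form covers both the torus inside the bounded families and
the centre inside the torus. -/
theorem StarSubalgebra.eq_top_of_isClosed_of_subset {B : Type*} [CStarAlgebra B]
    {T : StarSubalgebra ℂ B} (hT : IsClosed (T : Set B)) {s : Set B}
    (hTs : T ≤ (StarAlgebra.adjoin ℂ s).topologicalClosure) (hs : ∀ x ∈ s, x ∈ T)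
    {S : StarSubalgebra ℂ T} (hS : IsClosed (S : Set T))
    (hsS : ∀ x (hx : x ∈ s), ⟨x, hs x hx⟩ ∈ S) :
    S = ⊤ := by
  refine SetLike.ext fun x => ⟨fun _ => StarSubalgebra.mem_top, fun _ => ?_⟩
  have hcl : IsClosed ((S.map T.subtype : StarSubalgebra ℂ B) : Set B) :=
    hT.isClosedEmbedding_subtypeVal.isClosedMap _ hS
  have h : T ≤ S.map T.subtype := hTs.trans
    (StarSubalgebra.topologicalClosure_minimal
      (StarAlgebra.adjoin_le fun y hy => ⟨⟨y, hs y hy⟩, hsS y hy, rfl⟩) hcl)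
  obtain ⟨y, hy, hyx⟩ := h x.2
  rwa [← Subtype.ext hyx]

/-! ### Generators of the torus and of its centre -/

namespace NCTorus

variable {θ : ℝ}

theorem eq_top_of_isClosed {S : StarSubalgebra ℂ (NCTorus θ)} (hS : IsClosed (S : Set (NCTorus θ)))
    (hU : U θ ∈ S) (hV : V θ ∈ S) : S = ⊤ := by
  have hs : ∀ x ∈ ({univU θ, univV θ} : Set (Bounded θ)), x ∈ sub θ := fun x hx =>
    StarSubalgebra.le_topologicalClosure _ (StarAlgebra.subset_adjoin ℂ _ hx)
  refine StarSubalgebra.eq_top_of_isClosed_of_subset (T := sub θ) (S := S) inferInstance le_rfl hs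
    hS ?_
  rintro x (rfl | rfl)
  · exact hU
  · exact hV

/-- The star centralizer of `b` is closed. It contains every unitary commuting with `b`, because the
adjoint of a unitary is its inverse and commutes with `b` too; so it contains the generators. -/
theorem mem_center_of_commute {b : NCTorus θ} (hU : U θ * b = b * U θ) (hV : V θ * b = b * V θ) :
    b ∈ Subalgebra.center ℂ (NCTorus θ) := by
  have key : ∀ x ∈ unitary (NCTorus θ), x * b = b * x →
      x ∈ StarSubalgebra.centralizer ℂ {b} := by
    intro x hx hxb
    have h1 : Commute (star x) b := (Commute.units_inv_left (u := Unitary.toUnits ⟨x, hx⟩) hxb :)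
    refine (StarSubalgebra.mem_centralizer_iff ℂ).2 ?_
    rintro _ rfl
    refine ⟨hxb.symm, ?_⟩
    simpa using congrArg star h1.eq
  have htop := eq_top_of_isClosed (θ := θ) (S := StarSubalgebra.centralizer ℂ {b})
    (by rw [StarSubalgebra.coe_centralizer]; exact Set.isClosed_centralizer _)
    (key _ (U_mem_unitary θ) hU) (key _ (V_mem_unitary θ) hV)
  refine Subalgebra.mem_center_iff.2 fun x => ?_
  have hx : x ∈ StarSubalgebra.centralizer ℂ {b} := htop ▸ StarSubalgebra.mem_top
  exact (((StarSubalgebra.mem_centralizer_iff ℂ).1 hx) b rfl).1.symm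

theorem isPrimitiveRoot_exp {n : ℤ} {m : ℕ} (hm : 0 < m) (hnm : IsCoprime n (m : ℤ)) :
    IsPrimitiveRoot (Complex.exp (2 * Real.pi * Complex.I * ((n : ℝ) / (m : ℝ) : ℝ))) m := by
  have h := (Complex.isPrimitiveRoot_exp m hm.ne').zpow_of_gcd_eq_one n
    (Int.isCoprime_iff_gcd_eq_one.1 hnm)
  rw [← Complex.exp_int_mul] at h
  have heq : 2 * Real.pi * Complex.I * ((n : ℝ) / (m : ℝ) : ℝ) =
      n * (2 * Real.pi * Complex.I / m) := by
    push_cast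
    ring
  rwa [heq]

/-- The generators of a rational noncommutative torus. -/
noncomputable def rotationPair {n : ℤ} {m : ℕ} (hm : 0 < m) (hnm : IsCoprime n (m : ℤ)) :
    RotationPair (NCTorus ((n : ℝ) / (m : ℝ))) m where
  u := Unitary.toUnits ⟨U _, U_mem_unitary _⟩
  v := Unitary.toUnits ⟨V _, V_mem_unitary _⟩
  z := Complex.exp (2 * Real.pi * Complex.I * ((n : ℝ) / (m : ℝ) : ℝ))
  primitive := isPrimitiveRoot_exp hm hnm
  comm := U_mul_V _
  mem_center _ := mem_center_of_commute

theorem star_coe_u {n : ℤ} {m : ℕ} (hm : 0 < m) (hnm : IsCoprime n (m : ℤ)) :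
    star ((rotationPair hm hnm).u : NCTorus ((n : ℝ) / (m : ℝ))) = ↑(rotationPair hm hnm).u⁻¹ := rfl

theorem star_coe_v {n : ℤ} {m : ℕ} (hm : 0 < m) (hnm : IsCoprime n (m : ℤ)) :
    star ((rotationPair hm hnm).v : NCTorus ((n : ℝ) / (m : ℝ))) = ↑(rotationPair hm hnm).v⁻¹ := rfl

theorem isClosed_starCenter (B : Type*) [CStarAlgebra B] : IsClosed (starCenter B : Set B) := by
  have : (starCenter B : Set B) = Set.centralizer Set.univ := (Set.centralizer_univ B).symm
  rw [this]
  exact Set.isClosed_centralizer _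

theorem U_pow_mem_starCenter {n : ℤ} {m : ℕ} (hm : 0 < m) (hnm : IsCoprime n (m : ℤ)) :
    U ((n : ℝ) / (m : ℝ)) ^ m ∈ starCenter (NCTorus ((n : ℝ) / (m : ℝ))) :=
  haveI : NeZero m := ⟨hm.ne'⟩
  (rotationPair hm hnm).u_pow_mem_center

theorem V_pow_mem_starCenter {n : ℤ} {m : ℕ} (hm : 0 < m) (hnm : IsCoprime n (m : ℤ)) :
    V ((n : ℝ) / (m : ℝ)) ^ m ∈ starCenter (NCTorus ((n : ℝ) / (m : ℝ))) :=
  (rotationPair hm hnm).v_pow_mem_center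

/-- The centre of a rational noncommutative torus is generated by `U ^ m` and `V ^ m`. -/
theorem starCenter_le {n : ℤ} {m : ℕ} (hm : 0 < m) (hnm : IsCoprime n (m : ℤ)) :
    starCenter (NCTorus ((n : ℝ) / (m : ℝ))) ≤
      (StarAlgebra.adjoin ℂ {U ((n : ℝ) / (m : ℝ)) ^ m, V _ ^ m}).topologicalClosure := by
  have : NeZero m := ⟨hm.ne'⟩
  set p := rotationPair hm hnm
  set C := (StarAlgebra.adjoin ℂ {U ((n : ℝ) / (m : ℝ)) ^ m, V _ ^ m}).topologicalClosure with hC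
  have hCclosed : IsClosed (C : Set (NCTorus ((n : ℝ) / (m : ℝ)))) :=
    StarSubalgebra.isClosed_topologicalClosure _
  have hCle : C ≤ starCenter _ := by
    refine StarSubalgebra.topologicalClosure_minimal (StarAlgebra.adjoin_le ?_)
      (isClosed_starCenter _)
    rintro x (rfl | rfl)
    · exact U_pow_mem_starCenter hm hnm
    · exact V_pow_mem_starCenter hm hnm
  have hU : (p.u : NCTorus ((n : ℝ) / (m : ℝ))) ^ m ∈ C :=
    StarSubalgebra.le_topologicalClosure _ (StarAlgebra.subset_adjoin ℂ _ (Set.mem_insert _ _))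
  have hV : (p.v : NCTorus ((n : ℝ) / (m : ℝ))) ^ m ∈ C :=
    StarSubalgebra.le_topologicalClosure _
      (StarAlgebra.subset_adjoin ℂ _ (Set.mem_insert_of_mem _ rfl))
  have hU' : (↑(p.u⁻¹ ^ m) : NCTorus ((n : ℝ) / (m : ℝ))) ∈ C := by
    rw [Units.val_pow_eq_pow_val, ← star_coe_u hm hnm, ← star_pow]
    exact star_mem hU
  have hV' : (↑(p.v⁻¹ ^ m) : NCTorus ((n : ℝ) / (m : ℝ))) ∈ C := by
    rw [Units.val_pow_eq_pow_val, ← star_coe_v hm hnm, ← star_pow]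
    exact star_mem hV
  set D := StarAlgebra.adjoin ℂ {U ((n : ℝ) / (m : ℝ)), V _} with hD
  have hDtop : D.topologicalClosure = ⊤ := eq_top_of_isClosed
    (StarSubalgebra.isClosed_topologicalClosure _)
    (StarSubalgebra.le_topologicalClosure _ (StarAlgebra.subset_adjoin ℂ _ (Set.mem_insert _ _)))
    (StarSubalgebra.le_topologicalClosure _
      (StarAlgebra.subset_adjoin ℂ _ (Set.mem_insert_of_mem _ rfl)))
  have hDC : ∀ b ∈ D, p.average b ∈ C := by
    intro b hb
    have hb' : b ∈ Submodule.span ℂ (Submonoid.closure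
        (({U ((n : ℝ) / (m : ℝ)), V _} : Set (NCTorus ((n : ℝ) / (m : ℝ)))) ∪ star {U _, V _}) :
          Set (NCTorus ((n : ℝ) / (m : ℝ)))) := by
      rw [← StarAlgebra.adjoin_eq_span]
      exact hb
    have hsub : ({U ((n : ℝ) / (m : ℝ)), V _} : Set (NCTorus ((n : ℝ) / (m : ℝ)))) ∪
        star {U _, V _} ⊆ {↑p.u, ↑p.v, ↑p.u⁻¹, ↑p.v⁻¹} := by
      rintro x ((rfl | rfl) | hx)
      · exact Or.inl rfl
      · exact Or.inr (Or.inl rfl)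
      · rcases Set.mem_star.1 hx with hx | hx
        · exact Or.inr (Or.inr (Or.inl (by rw [← star_star x, hx]; rfl)))
        · exact Or.inr (Or.inr (Or.inr (by
            rw [Set.mem_singleton_iff, ← star_star x, Set.mem_singleton_iff.1 hx]; rfl)))
    have hle := Submodule.span_le (p := (Subalgebra.toSubmodule C.toSubalgebra).comap p.average).2
      fun w hw => p.average_word_mem (C := C.toSubalgebra) hCle hU hV hU' hV'
        (Submonoid.closure_mono hsub hw)
    exact hle hb'
  intro b hb
  have hbD : b ∈ closure (D : Set (NCTorus ((n : ℝ) / (m : ℝ)))) := by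
    rw [← StarSubalgebra.topologicalClosure_coe, hDtop]
    exact Set.mem_univ b
  -- The average maps the dense subalgebra `D` into the closed `C`, hence by continuity everything;
  -- a central `b` is its own average.
  have hav := hCclosed.closure_subset_iff.2 (Set.image_subset_iff.2 hDC)
    (image_closure_subset_closure_image p.continuous_average ⟨b, hbD, rfl⟩)
  rwa [p.average_of_mem_center hb] at hav

end NCTorus

/-! ### Clock and shift matrices -/

section ClockShift

variable {m : ℕ} [NeZero m]

/-- The clock matrix with parameter `a`. -/
def clockMatrix (m : ℕ) (z a : ℂ) : Matrix (ZMod m) (ZMod m) ℂ :=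
  Matrix.diagonal fun k => a * z ^ k.val

/-- The shift matrix with parameter `b`. -/
def shiftMatrix (m : ℕ) (b : ℂ) : Matrix (ZMod m) (ZMod m) ℂ :=
  Matrix.of fun i j => if i = j + 1 then b else 0

/-- The condition `z ^ m = 1` accounts for the wrap-around from `m - 1` to `0`. -/
theorem pow_val_add_one {z : ℂ} (hz : z ^ m = 1) (k : ZMod m) :
    z ^ (k + 1).val = z * z ^ k.val := by
  rw [ZMod.val_add, ZMod.val_one_eq_one_mod, Nat.add_mod_mod, ← pow_eq_pow_mod _ hz, pow_succ']

theorem clockMatrix_mul_shiftMatrix {z : ℂ} (hz : z ^ m = 1) (a b : ℂ) :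
    clockMatrix m z a * shiftMatrix m b = z • (shiftMatrix m b * clockMatrix m z a) := by
  ext i j
  simp only [clockMatrix, shiftMatrix, Matrix.diagonal_mul, Matrix.smul_apply, Matrix.mul_diagonal,
    Matrix.of_apply, smul_eq_mul]
  split_ifs with h
  · rw [h, pow_val_add_one hz]
    ring
  · simp

theorem clockMatrix_pow {z : ℂ} (hz : z ^ m = 1) (a : ℂ) :
    clockMatrix m z a ^ m = algebraMap ℂ _ (a ^ m) := by
  rw [clockMatrix, Matrix.diagonal_pow, Matrix.algebraMap_eq_diagonal]
  congr 1
  ext k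
  simp only [Pi.pow_apply, mul_pow, ← pow_mul, mul_comm _ m]
  rw [pow_mul, hz, one_pow, mul_one]
  rfl

theorem shiftMatrix_pow_apply (b : ℂ) (l : ℕ) (i j : ZMod m) :
    (shiftMatrix m b ^ l) i j = if i = j + l then b ^ l else 0 := by
  induction l generalizing j with
  | zero => simp [Matrix.one_apply]
  | succ l ih =>
    rw [pow_succ, Matrix.mul_apply, Finset.sum_eq_single (j + 1)]
    · rw [ih]
      simp only [shiftMatrix, Matrix.of_apply, if_true]
      have : j + 1 + (l : ZMod m) = j + ((l + 1 : ℕ) : ZMod m) := by push_cast; ring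
      rw [this]
      split_ifs
      · rw [pow_succ]
      · simp
    · intro k _ hk
      simp [shiftMatrix, hk]
    · simp

theorem shiftMatrix_pow (b : ℂ) : shiftMatrix m b ^ m = algebraMap ℂ _ (b ^ m) := by
  ext i j
  rw [shiftMatrix_pow_apply, Matrix.algebraMap_matrix_apply]
  simp

theorem clockMatrix_mem_unitary {z a : ℂ} (hz : ‖z‖ = 1) (ha : ‖a‖ = 1) :
    clockMatrix m z a ∈ unitary (Matrix (ZMod m) (ZMod m) ℂ) := by
  refine Matrix.mem_unitaryGroup_iff.2 ?_
  rw [Matrix.star_eq_conjTranspose, clockMatrix, Matrix.diagonal_conjTranspose,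
    Matrix.diagonal_mul_diagonal, ← Matrix.diagonal_one]
  congr 1
  ext k
  rw [Pi.star_apply, RCLike.star_def, RCLike.mul_conj]
  simp [hz, ha]

theorem shiftMatrix_mem_unitary {b : ℂ} (hb : ‖b‖ = 1) :
    shiftMatrix m b ∈ unitary (Matrix (ZMod m) (ZMod m) ℂ) := by
  refine Matrix.mem_unitaryGroup_iff.2 ?_
  ext i j
  rw [Matrix.star_eq_conjTranspose, Matrix.mul_apply, Finset.sum_eq_single (i - 1)]
  · simp only [shiftMatrix, Matrix.conjTranspose_apply, Matrix.of_apply, sub_add_cancel, if_true,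
      Matrix.one_apply, @eq_comm _ j i]
    split_ifs
    · rw [RCLike.star_def, RCLike.mul_conj]
      simp [hb]
    · simp
  · intro k _ hk
    have : i ≠ k + 1 := fun h => hk (by rw [h, add_sub_cancel_right])
    simp [shiftMatrix, this]
  · simp

end ClockShift

theorem Circle.exists_pow_eq (z : Circle) {m : ℕ} (hm : 0 < m) : ∃ a : Circle, a ^ m = z := by
  refine ⟨Circle.exp (Complex.arg z / m), ?_⟩
  rw [← Circle.exp_nsmul, nsmul_eq_mul, mul_div_cancel₀ _ (Nat.cast_ne_zero.2 hm.ne'),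
    Circle.exp_arg]

/-! ### Commutative C⋆-algebras generated by two unitaries -/

section Gelfand

open WeakDual

/-- A commutative C⋆-algebra generated by two unitaries with full joint spectrum is `C(𝕋²)`. -/
theorem exists_starAlgEquiv_torus {A : Type*} [CommCStarAlgebra A] {u v : A}
    (hu : u ∈ unitary A) (hv : v ∈ unitary A)
    (hgen : ∀ S : StarSubalgebra ℂ A, IsClosed (S : Set A) → u ∈ S → v ∈ S → S = ⊤)
    (hsurj : ∀ z w : Circle, ∃ χ : A →ₐ[ℂ] ℂ, χ u = z ∧ χ v = w) :
    ∃ Φ : A ≃⋆ₐ[ℂ] C(Circle × Circle, ℂ), Φ u = torusCoord₁ ∧ Φ v = torusCoord₂ := by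
  have hnorm : ∀ x ∈ unitary A, ∀ χ : characterSpace ℂ A, χ x ∈ Submonoid.unitSphere ℂ := by
    intro x hx χ
    refine mem_sphere_zero_iff_norm.2 ?_
    exact CStarRing.norm_of_mem_unitary (Unitary.map_mem χ hx)
  -- Joint evaluation at `u` and `v` is a continuous bijection from a compact space to a Hausdorff
  -- space, hence a homeomorphism.
  let e : characterSpace ℂ A → Circle × Circle := fun χ =>
    (⟨χ u, hnorm u hu χ⟩, ⟨χ v, hnorm v hv χ⟩)
  have he : Continuous e :=
    (((gelfandTransform ℂ A u).continuous.subtype_mk _).prodMk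
      ((gelfandTransform ℂ A v).continuous.subtype_mk _))
  have hinj : Function.Injective e := by
    intro χ χ' h
    have h1 : χ u = χ' u := congrArg (fun c : Circle × Circle => (c.1 : ℂ)) h
    have h2 : χ v = χ' v := congrArg (fun c : Circle × Circle => (c.2 : ℂ)) h
    -- Two characters agree on a closed star subalgebra; once it contains both generators it is
    -- everything.
    let S : StarSubalgebra ℂ A := StarAlgHom.equalizer
      (χ : A →⋆ₐ[ℂ] ℂ) (χ' : A →⋆ₐ[ℂ] ℂ)
    have hS : S = ⊤ := hgen S (isClosed_eq (map_continuous χ) (map_continuous χ')) h1 h2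
    refine DFunLike.ext _ _ fun a => ?_
    have : a ∈ S := hS ▸ StarSubalgebra.mem_top
    exact this
  have hsur : Function.Surjective e := by
    rintro ⟨z, w⟩
    obtain ⟨χ, h1, h2⟩ := hsurj z w
    exact ⟨CharacterSpace.equivAlgHom.symm χ, Prod.ext (Subtype.ext h1) (Subtype.ext h2)⟩
  let h : characterSpace ℂ A ≃ₜ Circle × Circle :=
    Continuous.homeoOfEquivCompactToT2 (f := Equiv.ofBijective e ⟨hinj, hsur⟩) he
  have hfst : ∀ c, (h.symm c : characterSpace ℂ A) u = c.1 := fun c => by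
    conv_rhs => rw [← h.apply_symm_apply c]
    rfl
  have hsnd : ∀ c, (h.symm c : characterSpace ℂ A) v = c.2 := fun c => by
    conv_rhs => rw [← h.apply_symm_apply c]
    rfl
  exact ⟨(gelfandStarTransform A).trans (h.symm.compStarAlgEquiv' ℂ ℂ),
    ContinuousMap.ext hfst, ContinuousMap.ext hsnd⟩

end Gelfand

/-- The centre of a C⋆-algebra is a commutative C⋆-algebra. -/
noncomputable abbrev starCenter.commCStarAlgebra (B : Type*) [CStarAlgebra B] :
    CommCStarAlgebra (starCenter B) :=
  haveI : IsClosed (starCenter B : Set B) := NCTorus.isClosed_starCenter B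
  { (inferInstance : CStarAlgebra (starCenter B)) with
    mul_comm := fun a b => Subtype.ext (Subalgebra.mem_center_iff.1 b.2 a) }

/-! ### Characters of the centre and its Gelfand spectrum -/

namespace NCTorus

open scoped CStarAlgebra Matrix.Norms.L2Operator in
-- Choose `m`-th roots `a`, `b` of `z`, `w` and represent the torus by the clock and shift matrices
-- with these parameters. Then `U ^ m` and `V ^ m` act by the scalars `z` and `w`; since they
-- generate the centre, the whole centre acts by scalars, and these scalars are the character.
theorem exists_character {n : ℤ} {m : ℕ} (hm : 0 < m) (hnm : IsCoprime n (m : ℤ))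
    (z w : Circle) : ∃ χ : starCenter (NCTorus ((n : ℝ) / (m : ℝ))) →ₐ[ℂ] ℂ,
      χ ⟨U _ ^ m, U_pow_mem_starCenter hm hnm⟩ = z ∧
      χ ⟨V _ ^ m, V_pow_mem_starCenter hm hnm⟩ = w := by
  have : NeZero m := ⟨hm.ne'⟩
  obtain ⟨a, rfl⟩ := Circle.exists_pow_eq z hm
  obtain ⟨b, rfl⟩ := Circle.exists_pow_eq w hm
  have hprim := isPrimitiveRoot_exp hm hnm
  set l := Complex.exp (2 * Real.pi * Complex.I * ((n : ℝ) / (m : ℝ) : ℝ)) with hl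
  obtain ⟨φ, ⟨hφU, hφV⟩, -⟩ := existsUnique_lift ((n : ℝ) / (m : ℝ))
    (clockMatrix m l a) (shiftMatrix m b)
    (clockMatrix_mem_unitary (hprim.norm'_eq_one hm.ne') a.norm_coe)
    (shiftMatrix_mem_unitary b.norm_coe) (clockMatrix_mul_shiftMatrix hprim.pow_eq_one _ _)
  have hU : φ (U _ ^ m) = algebraMap ℂ _ ((a : ℂ) ^ m) := by
    rw [map_pow, hφU, clockMatrix_pow hprim.pow_eq_one]
  have hV : φ (V _ ^ m) = algebraMap ℂ _ ((b : ℂ) ^ m) := by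
    rw [map_pow, hφV, shiftMatrix_pow]
  -- The central elements acting by scalars form a closed star subalgebra, the scalar matrices being
  -- a finite-dimensional subspace.
  let S : StarSubalgebra ℂ (starCenter (NCTorus ((n : ℝ) / (m : ℝ)))) :=
    (⊥ : StarSubalgebra ℂ (Matrix (ZMod m) (ZMod m) ℂ)).comap
      (φ.comp (starCenter (NCTorus ((n : ℝ) / (m : ℝ)))).subtype)
  have hbot : IsClosed ((⊥ : StarSubalgebra ℂ (Matrix (ZMod m) (ZMod m) ℂ)) :
      Set (Matrix (ZMod m) (ZMod m) ℂ)) :=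
    Submodule.closed_of_finiteDimensional (Subalgebra.toSubmodule
      (⊥ : StarSubalgebra ℂ (Matrix (ZMod m) (ZMod m) ℂ)).toSubalgebra)
  have hSclosed : IsClosed (S : Set (starCenter (NCTorus ((n : ℝ) / (m : ℝ))))) :=
    hbot.preimage ((map_continuous φ).comp continuous_subtype_val)
  have hS : S = ⊤ := by
    refine StarSubalgebra.eq_top_of_isClosed_of_subset (isClosed_starCenter _)
      (starCenter_le hm hnm) ?_ hSclosed ?_
    · rintro x (rfl | rfl)
      · exact U_pow_mem_starCenter hm hnm
      · exact V_pow_mem_starCenter hm hnm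
    · rintro x (rfl | rfl)
      · exact StarSubalgebra.mem_bot.2 ⟨_, hU.symm⟩
      · exact StarSubalgebra.mem_bot.2 ⟨_, hV.symm⟩
  have hscalar : ∀ x : starCenter (NCTorus ((n : ℝ) / (m : ℝ))),
      ∃ c : ℂ, algebraMap ℂ (Matrix (ZMod m) (ZMod m) ℂ) c = φ x := fun x =>
    StarSubalgebra.mem_bot.1 (show x ∈ S from hS ▸ StarSubalgebra.mem_top)
  choose χ hχ using hscalar
  have hinj : Function.Injective (algebraMap ℂ (Matrix (ZMod m) (ZMod m) ℂ)) :=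
    FaithfulSMul.algebraMap_injective _ _
  refine ⟨{ toFun := χ
            map_one' := hinj (by simp [hχ])
            map_mul' := fun x y => hinj (by simp [hχ])
            map_zero' := hinj (by simp [hχ])
            map_add' := fun x y => hinj (by simp [hχ])
            commutes' := fun c => hinj ((hχ _).trans (AlgHomClass.commutes φ c)) },
    hinj ((hχ _).trans hU), hinj ((hχ _).trans hV)⟩

theorem exists_starCenter_equiv {n : ℤ} {m : ℕ} (hm : 0 < m) (hnm : IsCoprime n (m : ℤ)) :
    ∃ Φ : starCenter (NCTorus ((n : ℝ) / (m : ℝ))) ≃⋆ₐ[ℂ] C(Circle × Circle, ℂ),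
      (Φ.symm torusCoord₁ : NCTorus ((n : ℝ) / (m : ℝ))) = U _ ^ m ∧
      (Φ.symm torusCoord₂ : NCTorus ((n : ℝ) / (m : ℝ))) = V _ ^ m := by
  let _ := starCenter.commCStarAlgebra (NCTorus ((n : ℝ) / (m : ℝ)))
  obtain ⟨Φ, h1, h2⟩ := exists_starAlgEquiv_torus
    (A := starCenter (NCTorus ((n : ℝ) / (m : ℝ))))
    (u := ⟨U _ ^ m, U_pow_mem_starCenter hm hnm⟩) (v := ⟨V _ ^ m, V_pow_mem_starCenter hm hnm⟩)
    (Unitary.mem_iff.2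
      ⟨Subtype.ext (Unitary.mem_iff.1 (pow_mem (U_mem_unitary ((n : ℝ) / (m : ℝ))) m)).1,
        Subtype.ext (Unitary.mem_iff.1 (pow_mem (U_mem_unitary ((n : ℝ) / (m : ℝ))) m)).2⟩)
    (Unitary.mem_iff.2
      ⟨Subtype.ext (Unitary.mem_iff.1 (pow_mem (V_mem_unitary ((n : ℝ) / (m : ℝ))) m)).1,
        Subtype.ext (Unitary.mem_iff.1 (pow_mem (V_mem_unitary ((n : ℝ) / (m : ℝ))) m)).2⟩)
    (fun S hS hu hv => StarSubalgebra.eq_top_of_isClosed_of_subset (isClosed_starCenter _)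
      (starCenter_le hm hnm) (by
        rintro x (rfl | rfl)
        · exact U_pow_mem_starCenter hm hnm
        · exact V_pow_mem_starCenter hm hnm) hS (by
        rintro x (rfl | rfl)
        · exact hu
        · exact hv))
    (exists_character hm hnm)
  refine ⟨Φ, ?_, ?_⟩
  · rw [← h1]
    exact congrArg Subtype.val (Φ.symm_apply_apply _)
  · rw [← h2]
    exact congrArg Subtype.val (Φ.symm_apply_apply _)

end NCTorus

theorem proposition13 (n : ℤ) (m : ℕ) (hm : 0 < m) (hnm : IsCoprime n (m : ℤ)) :
    -- the centre of the noncommutative torus is the commutative torus `C(𝕋²)`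
    (∃ Φ : starCenter (NCTorus ((n : ℝ) / (m : ℝ))) ≃⋆ₐ[ℂ] C(Circle × Circle, ℂ),
      (Φ.symm torusCoord₁ : NCTorus ((n : ℝ) / (m : ℝ))) = NCTorus.U _ ^ m ∧
      (Φ.symm torusCoord₂ : NCTorus ((n : ℝ) / (m : ℝ))) = NCTorus.V _ ^ m) ∧
    -- the noncommutative torus is a local covering of its centre, with symmetry `C(G, A)`
    -- for `G = ℤ/m × ℤ/m` and `A` the centre
    letI A : Subalgebra ℂ (NCTorus ((n : ℝ) / (m : ℝ))) := Subalgebra.center ℂ _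
    haveI : NeZero m := ⟨hm.ne'⟩
    ∃ 𝓗 : HopfAlgebroid ℂ A A (Multiplicative (ZMod m × ZMod m) → A),
      𝓗.IsCommutative ∧ 𝓗.IsFunctionAlgebra ∧ Nonempty (LocalNCCovering A 𝓗) := by
  have : NeZero m := ⟨hm.ne'⟩
  exact ⟨NCTorus.exists_starCenter_equiv hm hnm,
    functionHopfAlgebroid ℂ _ (mul_comm_of_le_center le_rfl),
    functionHopfAlgebroid_isCommutative _, functionHopfAlgebroid_isFunctionAlgebra _,
    ⟨(NCTorus.rotationPair hm hnm).isGaloisCoordinates.localCovering le_rfl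
      (NCTorus.rotationPair hm hnm).mem_center_iff⟩⟩
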